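/- Let $\mathfrak g=\mathfrak{su}(3)$ be the Lie algebra of trace-free skew-Hermitian complex $3\times3$ matrices, let $\sigma(X)=\overline X$ (entrywise conjugation) be the involution of the symmetric space $\mathrm{SU}(3)/\mathrm{SO}(3)$, and let $\mathfrak m=\{X\in\mathfrak g:\sigma(X)=-X\}$ be its tangent space at the origin, with curvature tensor $R(u,v)w=-[[u,v],w]$ and with the isotropy action $A\mapsto kAk^{-1}$ of $k\in\mathrm{SO}(3)$. Fix an invariant inner product $\langle A,B\rangle=c\,\operatorname{Re}\operatorname{tr}(B^*A)$, $c>0$. A linear subspace $U\subseteq\mathfrak m$ is a *Lie triple system* if $R(u,v)w\in U$ for all $u,v,w\in U$; it is *flat* if $R(u,v)w=0$ for all $u,v,w\in U$. A *maximal* Lie triple system is one that is maximal with respect to inclusion among the Lie triple systems different from $\mathfrak m$. Let $\mathfrak a$ be a maximal flat subspace of $\mathfrak m$. A non-zero linear form $\alpha:\mathfrak a\to\mathbb C$ is a *root* if there is $0\ne X\in\mathfrak g$ with $\operatorname{ad}(H)^2X=\alpha(H)^2X$ for all $H\in\mathfrak a$; roots are purely imaginary. If $H_0\in\mathfrak a$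 is such that no root vanishes at $H_0$, the roots $\alpha$ with $\alpha(H_0)\in i\mathbb R_{>0}$ are called positive, and the positive roots that are not the sum of two positive roots form a *system of simple roots* $\{\alpha_1,\alpha_2\}$. Put $\alpha_3=\alpha_1+\alpha_2$, and for a root $\alpha$ let $H_\alpha\in\mathfrak a$ be the vector with $\langle H_\alpha,\cdot\rangle=\frac1i\alpha$ on $\mathfrak a$; write $H_3=H_{\alpha_3}$. An *adapted Chevalley basis* is a family of $X_\alpha\in\mathfrak g^{\mathbb C}=\mathfrak{sl}(3,\mathbb C)$, $\alpha$ running through the roots, with $[H,X_\alpha]=\alpha(H)X_\alpha$ for $H\in\mathfrak a$, such that, with real constants $c_{\alpha,\beta}$ satisfying $c_{-\alpha,-\beta}=-c_{\alpha,\beta}$, one has $[X_\alpha,X_\beta]=c_{\alpha,\beta}X_{\alpha+\beta}$ if $\alpha+\beta$ is a root, $[X_\alpha,X_{-\alpha}]=-iH_\alpha$, and $[X_\alpha,X_\beta]=0$ otherwise; such that $X_{-\alpha}=X_\alpha^*$ (i.e. minus the conjugate of $X_\alpha$ with respect to the real form $\mathfrak{su}(3)$); and such that $\sigma(X_{\alpha_k})=X_{-\alpha_k}$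 for $k=1,2$, where $\sigma$ is extended complex linearly to $\sigma(X)=-X^T$. Put $V_\alpha(z)=\frac1{\sqrt2}(zX_\alpha-\bar zX_{-\alpha})$ for $z\in\mathbb C$, and for $t\in\mathbb R$ put $M_\alpha(t)=V_\alpha(t)$ if $\sigma(X_\alpha)=X_{-\alpha}$, and $M_\alpha(t)=V_\alpha(it)$ otherwise (then $\sigma(X_\alpha)=-X_{-\alpha}$). A linear subspace $\mathfrak m'\subseteq\mathfrak m$ is said to be of one of the following types if, for a suitable maximal flat subspace $\mathfrak a$ of $\mathfrak m$, a suitable system of simple roots $\{\alpha_1,\alpha_2\}$ and a suitable adapted Chevalley basis: - (G) $\mathfrak m'=\mathbb R H$ with some $0\neq H\in\mathfrak a$; - (T) $\mathfrak m'=\mathfrak a$; - (S) $\mathfrak m'=\mathbb R H_3\oplus\mathbb R M_{\alpha_3}(1)$; - (M) $\mathfrak m'=\mathbb R H_3\oplus\mathbb R\,(M_{\alpha_1}(1)+M_{\alpha_2}(1))$; - (P) $\mathfrak m'=\mathfrak a\oplus\mathbb R M_{\alpha_3}(1)$. **Proposition.** (1) A linear subspace $\{0\}\ne\mathfrak m'\subsetneq\mathfrak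 m$ is a Lie triple system if and only if it is of one of the types (G), (T), (S), (M), (P). (2) Two Lie triple systems of types other than (G) are congruent under the isotropy action on $\mathfrak m$ if and only if they are of the same type. (3) A Lie triple system is maximal if and only if it is of type (P) or of type (M). -/

import Mathlib

namespace SU3SO3

open Matrix Complex

attribute [local instance] LieRing.ofAssociativeRing

/-- Complex `3 × 3` matrices; all the spaces below are real subspaces of this one, and `⁅A, B⁆` is
the commutator `A * B - B * A`. -/
abbrev Mat : Type := Matrix (Fin 3) (Fin 3) ℂ

/-- The Lie algebra `𝔤 = 𝔰𝔲(3)` of skew-Hermitian matrices of trace zero. -/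
def su3 : LieSubalgebra ℝ Mat where
  carrier := {X | Xᴴ = -X ∧ X.trace = 0}
  zero_mem' := by simp
  add_mem' := by
    rintro X Y ⟨hX, hX'⟩ ⟨hY, hY'⟩
    refine ⟨?_, ?_⟩
    · rw [conjTranspose_add, hX, hY]; abel
    · rw [trace_add, hX', hY', add_zero]
  smul_mem' := by
    rintro r X ⟨hX, hX'⟩
    refine ⟨?_, ?_⟩
    · rw [conjTranspose_smul, hX]; simp
    · rw [trace_smul, hX', smul_zero]
  lie_mem' := by
    rintro X Y ⟨hX, -⟩ ⟨hY, -⟩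
    refine ⟨?_, ?_⟩
    · rw [Ring.lie_def, conjTranspose_sub, conjTranspose_mul, conjTranspose_mul, hX, hY]
      simp
    · rw [Ring.lie_def, trace_sub, trace_mul_comm, sub_self]

/-- The complex conjugation of `𝔤^ℂ = 𝔰𝔩(3, ℂ)` with respect to its real form `𝔤 = 𝔰𝔲(3)`. -/
def conj (X : Mat) : Mat := -Xᴴ

/-- The involution `σ` of the symmetric space `SU(3)/SO(3)`, in its complex linear extension to
`𝔤^ℂ`. On `𝔰𝔲(3)` it is entrywise complex conjugation, see `sigma_eq_map_conj`. -/
def sigma (X : Mat) : Mat := -Xᵀ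

theorem sigma_eq_map_conj {X : Mat} (hX : X ∈ su3) : sigma X = X.map (starRingEnd ℂ) := by
  have h : Xᴴ = -X := hX.1
  ext i j
  have := congrFun (congrFun h j) i
  simp only [conjTranspose_apply] at this
  simp only [sigma, map_apply, starRingEnd_apply, this]
  rfl

/-- The space `𝔪 = Eig(σ, -1) ⊆ 𝔤`, i.e. the tangent space of `SU(3)/SO(3)` at the origin. -/
def m : Submodule ℝ Mat where
  carrier := {X | X ∈ su3 ∧ sigma X = -X}
  zero_mem' := ⟨su3.zero_mem, by simp [sigma]⟩
  add_mem' := by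
    rintro X Y ⟨hX, hX'⟩ ⟨hY, hY'⟩
    refine ⟨su3.add_mem hX hY, ?_⟩
    simp only [sigma, neg_inj] at hX' hY' ⊢
    rw [transpose_add, hX', hY']
  smul_mem' := by
    rintro r X ⟨hX, hX'⟩
    refine ⟨su3.smul_mem r hX, ?_⟩
    simp only [sigma, neg_inj] at hX' ⊢
    rw [transpose_smul, hX']

/-- The curvature tensor `R(u, v)w = -[[u, v], w]` of `SU(3)/SO(3)` at the origin. -/
def curvature (u v w : Mat) : Mat := -⁅⁅u, v⁆, w⁆

/-- Lie triple systems in `𝔪`: the linear subspaces of `𝔪` that are invariant under `R`. -/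
def IsLieTripleSystem (U : Submodule ℝ Mat) : Prop :=
  U ≤ m ∧ ∀ u ∈ U, ∀ v ∈ U, ∀ w ∈ U, curvature u v w ∈ U

/-- Maximal Lie triple systems: those that are maximal among the Lie triple systems `≠ 𝔪`. -/
def IsMaximalLieTripleSystem (U : Submodule ℝ Mat) : Prop :=
  Maximal (fun V : Submodule ℝ Mat => IsLieTripleSystem V ∧ V ≠ m) U

/-- Flat subspaces of `𝔪`: the curvature tensor vanishes on them. -/
def IsFlat (a : Submodule ℝ Mat) : Prop :=
  a ≤ m ∧ ∀ u ∈ a, ∀ v ∈ a, ∀ w ∈ a, curvature u v w = 0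

def IsMaximalFlat (a : Submodule ℝ Mat) : Prop := Maximal IsFlat a

/-- The isotropy action of `k ∈ SO(3)`: the linear map `A ↦ k A k⁻¹`. -/
noncomputable def isotropy (k : specialOrthogonalGroup (Fin 3) ℝ) : Mat →ₗ[ℝ] Mat where
  toFun A := (k : Matrix (Fin 3) (Fin 3) ℝ).map ofReal * A *
    ((k⁻¹ : specialOrthogonalGroup (Fin 3) ℝ) : Matrix (Fin 3) (Fin 3) ℝ).map ofReal
  map_add' A B := by rw [mul_add, add_mul]
  map_smul' r A := by simp

/-- Congruence of subspaces under the isotropy action. -/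
def IsCongruent (U V : Submodule ℝ Mat) : Prop :=
  ∃ k : specialOrthogonalGroup (Fin 3) ℝ, U.map (isotropy k) = V

/-- The invariant inner product `⟨A, B⟩ = c · Re tr(B* A)`. As `c` runs through the positive reals,
this runs through all invariant inner products on `𝔰𝔲(3)`; the negative of the Killing form is
the case `c = 6`. -/
noncomputable def metric (c : ℝ) (A B : Mat) : ℝ := c * ((Bᴴ * A).trace).re

/-- Roots with respect to `a` (which is a Cartan subalgebra of `𝔤` if it is a maximal flat subspace
of `𝔪`). The complex linear forms on `a^ℂ` are written as the real linear maps `a → ℂ`. -/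
def roots (a : Submodule ℝ Mat) : Set (a →ₗ[ℝ] ℂ) :=
  {α | α ≠ 0 ∧ ∃ X ∈ su3, X ≠ 0 ∧
    ∀ H : a, ⁅(H : Mat), ⁅(H : Mat), X⁆⁆ = (α H) ^ 2 • X}

/-- The positive roots with respect to `H₀`: the roots `α` with `α(H₀) ∈ i ℝ₊`. -/
def positiveRoots (a : Submodule ℝ Mat) (H₀ : a) : Set (a →ₗ[ℝ] ℂ) :=
  {α | α ∈ roots a ∧ ∃ t : ℝ, 0 < t ∧ α H₀ = I * t}

/-- The simple roots: the positive roots that are not the sum of two positive roots. -/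
def simpleRoots (a : Submodule ℝ Mat) (H₀ : a) : Set (a →ₗ[ℝ] ℂ) :=
  {α | α ∈ positiveRoots a H₀ ∧
    ¬ ∃ β ∈ positiveRoots a H₀, ∃ γ ∈ positiveRoots a H₀, α = β + γ}

/-- `{α₁, α₂}`, with `α₁ ≠ α₂`, is a system of simple roots with respect to `a`. -/
def IsSimpleSystem (a : Submodule ℝ Mat) (α₁ α₂ : a →ₗ[ℝ] ℂ) : Prop :=
  α₁ ≠ α₂ ∧ ∃ H₀ : a, (∀ α ∈ roots a, α H₀ ≠ 0) ∧ simpleRoots a H₀ = {α₁, α₂}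

/-- The vector `H_α = ((1/i) α)^♯` of `a`, which represents the linear form `(1/i) α` on `a` with
respect to the inner product. For roots it exists and is unique, see `rootVector_spec` and
`rootVector_unique`. -/
noncomputable def rootVector (c : ℝ) (a : Submodule ℝ Mat) (α : a →ₗ[ℝ] ℂ) : Mat :=
  Classical.epsilon fun H : Mat => H ∈ a ∧ ∀ A : a, (metric c H A : ℂ) = 1 / I * α A

theorem trace_re_nonneg (A : Mat) : 0 ≤ ((Aᴴ * A).trace).re := by
  simp only [trace, diag_apply, mul_apply, conjTranspose_apply, re_sum, star_def]
  refine Finset.sum_nonneg fun i _ => Finset.sum_nonneg fun j _ => ?_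
  rw [← normSq_eq_conj_mul_self, ofReal_re]
  exact normSq_nonneg _

theorem trace_re_pos {A : Mat} (hA : A ≠ 0) : 0 < ((Aᴴ * A).trace).re := by
  refine lt_of_le_of_ne (trace_re_nonneg A) fun h => hA ?_
  simp only [trace, diag_apply, mul_apply, conjTranspose_apply, re_sum, star_def,
    ← normSq_eq_conj_mul_self, ofReal_re] at h
  have h1 := (Finset.sum_eq_zero_iff_of_nonneg
    (fun i _ => Finset.sum_nonneg fun j _ => normSq_nonneg (A j i))).1 h.symm
  ext i j
  have h2 := (Finset.sum_eq_zero_iff_of_nonneg (fun i _ => normSq_nonneg (A i j))).1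
    (h1 j (Finset.mem_univ j)) i (Finset.mem_univ i)
  simpa using h2

/-- Roots are purely imaginary. -/
theorem root_re_eq_zero {a : Submodule ℝ Mat} (ha : a ≤ m) {α : a →ₗ[ℝ] ℂ} (hα : α ∈ roots a)
    (H : a) : (α H).re = 0 := by
  obtain ⟨-, X, -, hX0, hX⟩ := hα
  have hH : (H : Mat)ᴴ = -(H : Mat) := (ha H.2).1.1
  have key : (Xᴴ * ⁅(H : Mat), ⁅(H : Mat), X⁆⁆).trace
      = -((⁅(H : Mat), X⁆)ᴴ * ⁅(H : Mat), X⁆).trace := by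
    generalize (H : Mat) = B at hH
    generalize hC : ⁅B, X⁆ = C
    have hC' : Cᴴ = -(Xᴴ * B) + B * Xᴴ := by
      rw [← hC, Ring.lie_def, conjTranspose_sub, conjTranspose_mul, conjTranspose_mul, hH]
      simp
    rw [hC', Ring.lie_def, mul_sub, trace_sub, add_mul, trace_add, neg_mul, trace_neg,
      mul_assoc, mul_assoc B Xᴴ C, trace_mul_comm B (Xᴴ * C), mul_assoc Xᴴ C B]
    ring
  rw [hX H, Matrix.mul_smul, trace_smul, smul_eq_mul] at key
  have hp := trace_re_pos hX0
  have hn := trace_re_nonneg ⁅(H : Mat), X⁆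
  have him : ((Xᴴ * X).trace).im = 0 := by
    simp only [trace, diag_apply, mul_apply, conjTranspose_apply, im_sum, star_def,
      ← normSq_eq_conj_mul_self, ofReal_im, Finset.sum_const_zero]
  have him' : ((⁅(H : Mat), X⁆ᴴ * ⁅(H : Mat), X⁆).trace).im = 0 := by
    simp only [trace, diag_apply, mul_apply, conjTranspose_apply, im_sum, star_def,
      ← normSq_eq_conj_mul_self, ofReal_im, Finset.sum_const_zero]
  have hre := congrArg re key
  have himm := congrArg im key
  simp only [mul_re, mul_im, him, him', neg_re, neg_im, pow_two] at hre himm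
  set x := (α H).re
  set y := (α H).im
  set p := ((Xᴴ * X).trace).re
  have h1 : (x * y + y * x) * p = 0 := by linarith
  have h2 : (x * x - y * y) * p ≤ 0 := by linarith
  have h3 : x * y + y * x = 0 := by
    rcases mul_eq_zero.1 h1 with h | h
    · exact h
    · exact absurd h hp.ne'
  have h4 : x * x - y * y ≤ 0 := by
    by_contra hcon
    push Not at hcon
    have := mul_pos hcon hp
    linarith
  by_contra hx
  have hy : y = 0 := by
    have : x * y = 0 := by linarith
    exact (mul_eq_zero.1 this).resolve_left hx
  rw [hy] at h4
  have : 0 < x * x := mul_self_pos.2 hx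
  linarith

theorem rootVector_unique {c : ℝ} (hc : 0 < c) {a : Submodule ℝ Mat} {H H' : Mat}
    (hH : H ∈ a) (hH' : H' ∈ a) (h : ∀ A : a, metric c H A = metric c H' A) : H = H' := by
  by_contra hne
  have h0 : H - H' ≠ 0 := sub_ne_zero.2 hne
  have h1 := h ⟨H - H', a.sub_mem hH hH'⟩
  have h2 := mul_pos hc (trace_re_pos h0)
  simp only [metric] at h1
  rw [mul_sub, trace_sub, sub_re] at h2
  linarith

theorem rootVector_spec {c : ℝ} (hc : 0 < c) {a : Submodule ℝ Mat} (ha : a ≤ m)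
    {α : a →ₗ[ℝ] ℂ} (hα : α ∈ roots a) :
    rootVector c a α ∈ a ∧ ∀ A : a, (metric c (rootVector c a α) A : ℂ) = 1 / I * α A := by
  have hex : ∃ H : Mat, H ∈ a ∧ ∀ A : a, (metric c H A : ℂ) = 1 / I * α A := by
    let T : a →ₗ[ℝ] (a →ₗ[ℝ] ℝ) := LinearMap.mk₂ ℝ (fun H A : a => metric c (H : Mat) (A : Mat))
      (fun x y z => by simp [metric, mul_add])
      (fun r x z => by simp [metric]; ring)
      (fun x y z => by simp [metric, add_mul, mul_add])
      (fun r x z => by simp [metric]; ring)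
    have hT : Function.Injective T := by
      intro x y hxy
      exact Subtype.ext (rootVector_unique hc x.2 y.2 fun A => LinearMap.congr_fun hxy A)
    have hS : Function.Surjective T :=
      (LinearMap.injective_iff_surjective_of_finrank_eq_finrank
        (Subspace.dual_finrank_eq (K := ℝ) (V := a)).symm).1 hT
    obtain ⟨H, hH⟩ := hS (imLm ∘ₗ α)
    refine ⟨H, H.2, fun A => ?_⟩
    have h1 : metric c H A = (α A).im := LinearMap.congr_fun hH A
    have h2 := root_re_eq_zero ha hα A
    rw [h1]
    apply Complex.ext <;> simp [h2]
  exact Classical.epsilon_spec hex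

/-- Chevalley bases `(X_α)` of `𝔤^ℂ = 𝔰𝔩(3, ℂ)` with respect to `a`; only the values of `X` on the
roots matter. The vector `α^♯` of `i a`, which represents `α` with respect to the complex
bilinear extension of `-⟨·, ·⟩`, is `-i H_α`. -/
structure IsChevalleyBasis (c : ℝ) (a : Submodule ℝ Mat) (X : (a →ₗ[ℝ] ℂ) → Mat) : Prop where
  mem_sl : ∀ α ∈ roots a, X α ∈ LieAlgebra.SpecialLinear.sl (Fin 3) ℂ
  mem_rootSpace : ∀ α ∈ roots a, ∀ H : a, ⁅(H : Mat), X α⁆ = α H • X α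
  exists_constants : ∃ N : (a →ₗ[ℝ] ℂ) → (a →ₗ[ℝ] ℂ) → ℝ, ∀ α ∈ roots a, ∀ β ∈ roots a,
    (α + β ∈ roots a → ⁅X α, X β⁆ = N α β • X (α + β)) ∧
    (α + β = 0 → ⁅X α, X β⁆ = (-I) • rootVector c a α) ∧
    (α + β ∉ roots a → α + β ≠ 0 → ⁅X α, X β⁆ = 0) ∧
    N (-α) (-β) = -N α β

/-- Chevalley bases adapted to the real form `𝔤` (`X_{-α} = -conj X_α`) and to the involution
(`s_α = 1` for the two simple roots, where `σ(X_α) = s_α X_{σ(α)}`, `σ(α) = -α`). -/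
structure IsAdaptedChevalleyBasis (c : ℝ) (a : Submodule ℝ Mat) (α₁ α₂ : a →ₗ[ℝ] ℂ)
    (X : (a →ₗ[ℝ] ℂ) → Mat) : Prop extends IsChevalleyBasis c a X where
  neg_eq : ∀ α ∈ roots a, X (-α) = -conj (X α)
  sigma_fst : sigma (X α₁) = X (-α₁)
  sigma_snd : sigma (X α₂) = X (-α₂)

/-- `V_α(z) = (1/√2) (z X_α - z̄ X_{-α})`. -/
noncomputable def V {a : Submodule ℝ Mat} (X : (a →ₗ[ℝ] ℂ) → Mat) (α : a →ₗ[ℝ] ℂ) (z : ℂ) :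
    Mat :=
  ((1 / √2 : ℝ) : ℂ) • (z • X α - (starRingEnd ℂ z) • X (-α))

open Classical in
/-- `M_α(t)`: equal to `V_α(t)` if `s_α = 1`, and to `V_α(i t)` if `s_α = -1`. -/
noncomputable def M {a : Submodule ℝ Mat} (X : (a →ₗ[ℝ] ℂ) → Mat) (α : a →ₗ[ℝ] ℂ) (t : ℝ) : Mat :=
  if sigma (X α) = X (-α) then V X α t else V X α (I * t)

/-- `U` is the direct sum of `A` and `B`. -/
def IsDirectSum (U A B : Submodule ℝ Mat) : Prop := A ⊓ B = ⊥ ∧ U = A ⊔ B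

/-- The names of the five types. -/
inductive LTSType
  | G | T | S | M | P

/-- `U` is of the type `τ` relative to `a`, to the simple roots `α₁`, `α₂` and to `X`. -/
def IsOfTypeRel (c : ℝ) (a : Submodule ℝ Mat) (α₁ α₂ : a →ₗ[ℝ] ℂ) (X : (a →ₗ[ℝ] ℂ) → Mat)
    (U : Submodule ℝ Mat) : LTSType → Prop
  | .G => ∃ H ∈ a, H ≠ 0 ∧ U = Submodule.span ℝ {H}
  | .T => U = a
  | .S => IsDirectSum U (Submodule.span ℝ {rootVector c a (α₁ + α₂)})
      (Submodule.span ℝ {M X (α₁ + α₂) 1})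
  | .M => IsDirectSum U (Submodule.span ℝ {rootVector c a (α₁ + α₂)})
      (Submodule.span ℝ {M X α₁ 1 + M X α₂ 1})
  | .P => IsDirectSum U a (Submodule.span ℝ {M X (α₁ + α₂) 1})

/-- `U` is of the type `τ`: it is so relative to some maximal flat subspace `a` of `𝔪`, some system
of simple roots `{α₁, α₂}`, and some adapted Chevalley basis. -/
def IsOfType (c : ℝ) (τ : LTSType) (U : Submodule ℝ Mat) : Prop :=
  ∃ a : Submodule ℝ Mat, IsMaximalFlat a ∧ ∃ α₁ α₂ : a →ₗ[ℝ] ℂ, IsSimpleSystem a α₁ α₂ ∧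
    ∃ X : (a →ₗ[ℝ] ℂ) → Mat, IsAdaptedChevalleyBasis c a α₁ α₂ X ∧ IsOfTypeRel c a α₁ α₂ X U τ

end SU3SO3

namespace SU3SO3

open Matrix Complex

attribute [local instance] LieRing.ofAssociativeRing

/-! Multiplication by `i` identifies `𝔪` with the traceless real symmetric `3 × 3` matrices, on
which `SO(3)` acts by conjugation, and brackets of two elements of `𝔪` are real skew-symmetric, i.e.
infinitesimal rotations. Everything is reduced to explicit matrices by conjugation in `SO(3)`.

Let `U` be a Lie triple system, neither zero nor `𝔪`. If `U` is abelian, the spectral theorem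
diagonalises it simultaneously, and `U` is conjugate to a line in the diagonal plane `diagM` or to
that plane: types (G) and (T). Otherwise some `K = [u, v]` with `u, v ∈ U` is non-zero, and `ad K`
preserves `U` because `U` is invariant under the curvature. After a conjugation
(`exists_isotropy_sk`) `K` generates the rotations about the first axis. Under this circle `𝔪`
splits into real pieces of weights 0, 1, 2 and dimensions 1, 2, 2, and `U` is a sum of some of
these. Weight 1 together with any other piece generates all of `𝔪`, and weight 0 alone is abelian,
so what remains is weight 1, weight 2, or weights 0 and 2: up to conjugation, types (M), (S), (P).
This is `IsRotInvariant.classification`, and `classification` collects all the cases.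

The types themselves are defined through roots and Chevalley bases. A maximal flat subspace is a
conjugate of `diagM`, its roots are the differences of the eigenvalues, and simple roots are
consecutive differences once the eigenvalues are sorted. The conditions on an adapted basis
determine its vectors up to a few signs, of which only one, the relative sign `ε` of the two simple
root vectors, affects the spaces in question, and it changes them only by a conjugation. Hence a
space is of a given type exactly if it is conjugate to the standard one (`isOfType_iff`).

Congruence and maximality are settled by properties which are invariant under conjugation and
inherited by subspaces: being abelian, having a common kernel vector, having a common eigenvector,
consisting of singular matrices. -/

/-! ### The isotropy action and what it preserves -/

/-- The group `SO(3)`. -/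
abbrev SO3 : Type := specialOrthogonalGroup (Fin 3) ℝ

/-- Elements of `SO(3)` as complex matrices. -/
noncomputable def cmat (k : SO3) : Mat := (k : Matrix (Fin 3) (Fin 3) ℝ).map ofReal

theorem cmat_inv (k : SO3) : cmat k⁻¹ = (cmat k)ᵀ := by
  ext i j
  rfl

theorem cmat_one : cmat 1 = 1 := by
  simp [cmat]

theorem cmat_mul (k l : SO3) : cmat (k * l) = cmat k * cmat l := by
  ext i j
  simp [cmat, mul_apply]

theorem cmat_mul_transpose (k : SO3) : cmat k * (cmat k)ᵀ = 1 := by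
  rw [← cmat_inv, ← cmat_mul, mul_inv_cancel, cmat_one]

theorem transpose_mul_cmat (k : SO3) : (cmat k)ᵀ * cmat k = 1 := by
  rw [← cmat_inv, ← cmat_mul, inv_mul_cancel, cmat_one]

theorem cmat_conjTranspose (k : SO3) : (cmat k)ᴴ = (cmat k)ᵀ := by
  ext i j
  simp [cmat]

theorem isotropy_apply (k : SO3) (A : Mat) : isotropy k A = cmat k * A * (cmat k)ᵀ := by
  rw [← cmat_inv]
  rfl

theorem isotropy_one (A : Mat) : isotropy 1 A = A := by
  simp [isotropy_apply, cmat_one]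

theorem isotropy_isotropy (k l : SO3) (A : Mat) :
    isotropy k (isotropy l A) = isotropy (k * l) A := by
  simp [isotropy_apply, cmat_mul, mul_assoc]

@[simp] theorem isotropy_inv_apply (k : SO3) (A : Mat) : isotropy k⁻¹ (isotropy k A) = A := by
  rw [isotropy_isotropy, inv_mul_cancel, isotropy_one]

@[simp] theorem isotropy_apply_inv (k : SO3) (A : Mat) : isotropy k (isotropy k⁻¹ A) = A := by
  rw [isotropy_isotropy, mul_inv_cancel, isotropy_one]

theorem isotropy_injective (k : SO3) : Function.Injective (isotropy k) :=
  Function.LeftInverse.injective (isotropy_inv_apply k)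

theorem isotropy_mul (k : SO3) (A B : Mat) :
    isotropy k (A * B) = isotropy k A * isotropy k B := by
  simp only [isotropy_apply]
  calc cmat k * (A * B) * (cmat k)ᵀ = cmat k * A * 1 * (B * (cmat k)ᵀ) := by
        simp only [mul_assoc, one_mul]
    _ = _ := by
        rw [← transpose_mul_cmat k]
        simp only [mul_assoc]

theorem isotropy_lie (k : SO3) (A B : Mat) :
    isotropy k ⁅A, B⁆ = ⁅isotropy k A, isotropy k B⁆ := by
  simp only [Ring.lie_def, map_sub, isotropy_mul]

theorem isotropy_curvature (k : SO3) (A B C : Mat) :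
    isotropy k (curvature A B C) = curvature (isotropy k A) (isotropy k B) (isotropy k C) := by
  simp only [curvature, map_neg, isotropy_lie]

theorem isotropy_smul (k : SO3) (z : ℂ) (A : Mat) : isotropy k (z • A) = z • isotropy k A := by
  simp [isotropy_apply]

theorem isotropy_transpose (k : SO3) (A : Mat) : isotropy k Aᵀ = (isotropy k A)ᵀ := by
  simp [isotropy_apply, mul_assoc]

theorem isotropy_conjTranspose (k : SO3) (A : Mat) : isotropy k Aᴴ = (isotropy k A)ᴴ := by
  have h : (cmat k)ᵀᴴ = cmat k := by rw [← cmat_conjTranspose, conjTranspose_conjTranspose]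
  simp [isotropy_apply, mul_assoc, h, cmat_conjTranspose]

theorem isotropy_trace (k : SO3) (A : Mat) : (isotropy k A).trace = A.trace := by
  rw [isotropy_apply, trace_mul_comm, ← mul_assoc, transpose_mul_cmat, one_mul]

theorem isotropy_det (k : SO3) (A : Mat) : (isotropy k A).det = A.det := by
  have h : (cmat k).det * (cmat k)ᵀ.det = 1 := by
    rw [← det_mul, cmat_mul_transpose, det_one]
  rw [isotropy_apply, det_mul, det_mul, mul_right_comm, h, one_mul]

theorem isotropy_mulVec (k : SO3) (A : Mat) (v : Fin 3 → ℂ) :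
    isotropy k A *ᵥ (cmat k *ᵥ v) = cmat k *ᵥ (A *ᵥ v) := by
  rw [isotropy_apply, mulVec_mulVec, mul_assoc, transpose_mul_cmat, mul_one, mulVec_mulVec]

theorem cmat_mulVec_ne_zero (k : SO3) {v : Fin 3 → ℂ} (hv : v ≠ 0) : cmat k *ᵥ v ≠ 0 := by
  intro h
  apply hv
  have := congrArg ((cmat k)ᵀ *ᵥ ·) h
  simpa [mulVec_mulVec, transpose_mul_cmat] using this

theorem isotropy_mem_su3 (k : SO3) {A : Mat} (hA : A ∈ su3) : isotropy k A ∈ su3 := by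
  refine ⟨?_, ?_⟩
  · rw [← isotropy_conjTranspose, hA.1, map_neg]
  · rw [isotropy_trace, hA.2]

theorem isotropy_sigma (k : SO3) (A : Mat) : isotropy k (sigma A) = sigma (isotropy k A) := by
  simp only [sigma, map_neg, isotropy_transpose]

theorem isotropy_mem_m (k : SO3) {A : Mat} (hA : A ∈ m) : isotropy k A ∈ m := by
  refine ⟨isotropy_mem_su3 k hA.1, ?_⟩
  rw [← isotropy_sigma, hA.2, map_neg]

theorem isotropy_metric (k : SO3) (c : ℝ) (A B : Mat) :
    metric c (isotropy k A) (isotropy k B) = metric c A B := by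
  simp only [metric, ← isotropy_conjTranspose, ← isotropy_mul, isotropy_trace]

theorem map_isotropy_map_isotropy (k l : SO3) (U : Submodule ℝ Mat) :
    (U.map (isotropy l)).map (isotropy k) = U.map (isotropy (k * l)) := by
  rw [← Submodule.map_comp]
  congr 1
  ext A : 1
  exact isotropy_isotropy k l A

theorem map_isotropy_one (U : Submodule ℝ Mat) : U.map (isotropy 1) = U := by
  have : isotropy 1 = LinearMap.id := LinearMap.ext isotropy_one
  rw [this, Submodule.map_id]

theorem map_isotropy_inv_map (k : SO3) (U : Submodule ℝ Mat) :
    (U.map (isotropy k)).map (isotropy k⁻¹) = U := by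
  rw [map_isotropy_map_isotropy, inv_mul_cancel, map_isotropy_one]

theorem map_isotropy_map_inv (k : SO3) (U : Submodule ℝ Mat) :
    (U.map (isotropy k⁻¹)).map (isotropy k) = U := by
  rw [map_isotropy_map_isotropy, mul_inv_cancel, map_isotropy_one]

theorem mem_map_isotropy {k : SO3} {U : Submodule ℝ Mat} {A : Mat} :
    A ∈ U.map (isotropy k) ↔ isotropy k⁻¹ A ∈ U := by
  constructor
  · rintro ⟨B, hB, rfl⟩
    simpa using hB
  · intro h
    exact ⟨_, h, isotropy_apply_inv k A⟩

theorem map_isotropy_m (k : SO3) : m.map (isotropy k) = m := by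
  ext A
  rw [mem_map_isotropy]
  refine ⟨fun h => ?_, isotropy_mem_m _⟩
  simpa using isotropy_mem_m k h

theorem IsLieTripleSystem.map_isotropy {U : Submodule ℝ Mat} (hU : IsLieTripleSystem U)
    (k : SO3) : IsLieTripleSystem (U.map (isotropy k)) := by
  refine ⟨?_, ?_⟩
  · rw [← map_isotropy_m k]
    exact Submodule.map_mono hU.1
  · rintro _ ⟨u, hu, rfl⟩ _ ⟨v, hv, rfl⟩ _ ⟨w, hw, rfl⟩
    rw [← isotropy_curvature]
    exact Submodule.mem_map_of_mem (hU.2 u hu v hv w hw)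

/-! ### Flat subspaces and simultaneous diagonalisation -/

/-- With `C = [u, v]`, invariance of the trace form gives `tr(C* C) = -tr([C, u] v)`. The right side
vanishes by flatness, and the left side is positive unless `C = 0`. -/
theorem lie_eq_zero_of_isFlat {a : Submodule ℝ Mat} (ha : IsFlat a) {u v : Mat} (hu : u ∈ a)
    (hv : v ∈ a) : ⁅u, v⁆ = 0 := by
  by_contra h
  have h1 := trace_re_pos h
  have h2 : ⁅⁅u, v⁆, u⁆ = 0 := neg_eq_zero.1 (ha.2 u hu v hv u hu)
  have hu' : uᴴ = -u := (ha.1 hu).1.1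
  have hv' : vᴴ = -v := (ha.1 hv).1.1
  have h3 : ⁅u, v⁆ᴴ = -⁅u, v⁆ := by
    rw [Ring.lie_def, conjTranspose_sub, conjTranspose_mul, conjTranspose_mul, hu', hv']
    simp
  have h4 : (⁅u, v⁆ᴴ * ⁅u, v⁆).trace = -(⁅⁅u, v⁆, u⁆ * v).trace := by
    rw [h3]
    generalize hC : ⁅u, v⁆ = C
    have e : C * C = C * u * v - C * v * u := by
      conv_lhs => rw [← hC]
      rw [Ring.lie_def, hC.symm, Ring.lie_def]
      noncomm_ring
    rw [neg_mul, trace_neg, e, Ring.lie_def, sub_mul, trace_sub, trace_sub, mul_assoc C v u,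
      ← trace_mul_cycle, mul_assoc u C v, trace_mul_comm u (C * v), mul_assoc C v u]
  rw [h4, h2] at h1
  simp at h1

theorem isFlat_iff {a : Submodule ℝ Mat} :
    IsFlat a ↔ a ≤ m ∧ ∀ u ∈ a, ∀ v ∈ a, ⁅u, v⁆ = 0 := by
  refine ⟨fun h => ⟨h.1, fun u hu v hv => lie_eq_zero_of_isFlat h hu hv⟩, fun h => ⟨h.1, ?_⟩⟩
  intro u hu v hv w _
  rw [curvature, h.2 u hu v hv, zero_lie, neg_zero]

/-- A commuting family of symmetric operators has an orthonormal basis of common eigenvectors. -/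
theorem exists_orthonormalBasis_joint_eigenvectors {ι E : Type*} [NormedAddCommGroup E]
    [InnerProductSpace ℝ E] [FiniteDimensional ℝ E] {n : ℕ} (hn : Module.finrank ℝ E = n)
    {T : ι → E →ₗ[ℝ] E} (hT : ∀ i, (T i).IsSymmetric) (hC : ∀ i j, Commute (T i) (T j)) :
    ∃ (b : OrthonormalBasis (Fin n) ℝ E) (χ : ι → Fin n → ℝ), ∀ i j, T i (b j) = χ i j • b j := by
  classical
  set A : (ι → ℝ) → Submodule ℝ E := fun χ => ⨅ i, Module.End.eigenspace (T i) (χ i) with hA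
  have hI : DirectSum.IsInternal A :=
    LinearMap.IsSymmetric.directSum_isInternal_of_pairwise_commute hT fun i j _ => hC i j
  have hO : OrthogonalFamily ℝ (fun χ => A χ) fun χ => (A χ).subtypeₗᵢ :=
    LinearMap.IsSymmetric.orthogonalFamily_iInf_eigenspaces hT
  -- The family of joint eigenspaces is indexed by all of `ι → ℝ`; independence leaves only finitely
  -- many non-zero ones, and an orthonormal basis is chosen subordinate to those.
  have hfin : Finite {χ // A χ ≠ ⊥} :=
    (WellFoundedGT.finite_ne_bot_of_iSupIndep hI.submodule_iSupIndep).to_subtype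
  have := Fintype.ofFinite {χ // A χ ≠ ⊥}
  have hI' := DirectSum.isInternal_ne_bot_iff.2 hI
  have hO' : OrthogonalFamily ℝ (fun χ : {χ // A χ ≠ ⊥} => A χ) fun χ => (A χ).subtypeₗᵢ :=
    hO.comp Subtype.val_injective
  refine ⟨hI'.subordinateOrthonormalBasis hn hO',
    fun i j => (hI'.subordinateOrthonormalBasisIndex hn j hO').1 i, fun i j => ?_⟩
  have h := hI'.subordinateOrthonormalBasis_subordinate hn j hO'
  exact Module.End.mem_eigenspace_iff.1 ((Submodule.mem_iInf _).1 h i)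

/-- A commuting family of real symmetric `3 × 3` matrices is simultaneously diagonalised by an
element of `SO(3)`, and the eigenvalues of one of them can be put into decreasing order. -/
theorem exists_SO3_diagonal {ι : Type*} (A : ι → Matrix (Fin 3) (Fin 3) ℝ)
    (hA : ∀ i, (A i)ᵀ = A i) (hC : ∀ i j, A i * A j = A j * A i) (i₀ : ι) :
    ∃ (k : SO3) (d : ι → Fin 3 → ℝ),
      (∀ i, A i = (k : Matrix (Fin 3) (Fin 3) ℝ) * diagonal (d i) *
        (k : Matrix (Fin 3) (Fin 3) ℝ)ᵀ) ∧ Antitone (d i₀) := by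
  have hT : ∀ i, (toEuclideanLin (A i)).IsSymmetric := fun i =>
    isSymmetric_toEuclideanLin_iff.2 (by rw [IsHermitian, conjTranspose_eq_transpose_of_trivial, hA])
  have hC' : ∀ i j, Commute (toEuclideanLin (A i)) (toEuclideanLin (A j)) := by
    intro i j
    refine LinearMap.ext fun v => ?_
    simp only [Module.End.mul_apply, toLpLin_apply, mulVec_mulVec, hC i j]
  obtain ⟨b, χ, hb⟩ := exists_orthonormalBasis_joint_eigenvectors
    (finrank_euclideanSpace_fin (𝕜 := ℝ) (n := 3)) hT hC'
  -- Sorting the negatives increasingly puts the eigenvalues of `A i₀` into decreasing order.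
  set π := Tuple.sort fun j => -χ i₀ j with hπ
  set Q : Matrix (Fin 3) (Fin 3) ℝ := of fun r j => b (π j) r with hQ
  have hQQ : Qᵀ * Q = 1 := by
    ext p q
    have h := orthonormal_iff_ite.1 b.orthonormal (π q) (π p)
    rw [PiLp.inner_apply] at h
    simp only [mul_apply, transpose_apply, hQ, of_apply, one_apply]
    simp only [RCLike.inner_apply, conj_trivial, π.injective.eq_iff] at h
    rw [h]
    simp [eq_comm]
  have hQQ' : Q * Qᵀ = 1 := mul_eq_one_comm.1 hQQ
  have hAQ : ∀ i, A i * Q = Q * diagonal (χ i ∘ π) := by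
    intro i
    ext r j
    have h := congrArg (fun v => v r) (hb i (π j))
    simp only [toLpLin_apply, PiLp.smul_apply, smul_eq_mul] at h
    rw [mul_diagonal]
    simp only [mul_apply, hQ, of_apply, Function.comp_apply]
    rw [mul_comm, ← h]
    rfl
  have hA' : ∀ i, A i = Q * diagonal (χ i ∘ π) * Qᵀ := by
    intro i
    rw [← hAQ, mul_assoc, hQQ', mul_one]
  have hanti : Antitone (χ i₀ ∘ π) := fun p q hpq =>
    neg_le_neg_iff.1 (Tuple.monotone_sort (fun j => -χ i₀ j) hpq)
  have hdet : Q.det = 1 ∨ Q.det = -1 := by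
    have h := congrArg det hQQ
    rw [det_mul, det_transpose, det_one] at h
    exact mul_self_eq_one_iff.1 h
  rcases hdet with h | h
  · refine ⟨⟨Q, mem_specialOrthogonalGroup_iff.2 ⟨(mem_orthogonalGroup_iff _ _).2 hQQ', h⟩⟩,
      fun i => χ i ∘ π, hA', hanti⟩
  -- The dimension is odd, so `-Q` has determinant 1; conjugation does not see the sign.
  · refine ⟨⟨-Q, mem_specialOrthogonalGroup_iff.2 ⟨(mem_orthogonalGroup_iff _ _).2 ?_, ?_⟩⟩,
      fun i => χ i ∘ π, fun i => ?_, hanti⟩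
    · rw [transpose_neg, neg_mul_neg, hQQ']
    · rw [det_neg, h]
      norm_num
    · simpa using hA' i

/-! ### Coordinates on `𝔪`: brackets and curvature -/

/-- The matrix `i S`, where `S` is the real symmetric matrix with diagonal `a, b, c` and with
entries `x, y, z` above the diagonal. -/
noncomputable def sm (a b c x y z : ℝ) : Mat :=
  I • !![(a : ℂ), x, y; x, b, z; y, z, c]

/-- The real skew-symmetric matrix with entries `u, v, w` above the diagonal. -/
noncomputable def sk (u v w : ℝ) : Mat :=
  !![0, (u : ℂ), v; -u, 0, w; -v, -w, 0]

theorem sm_add (a b c x y z a' b' c' x' y' z' : ℝ) :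
    sm a b c x y z + sm a' b' c' x' y' z' =
      sm (a + a') (b + b') (c + c') (x + x') (y + y') (z + z') := by
  ext i j
  fin_cases i <;> fin_cases j <;> simp [sm] <;> ring

theorem smul_sm (r a b c x y z : ℝ) :
    r • sm a b c x y z = sm (r * a) (r * b) (r * c) (r * x) (r * y) (r * z) := by
  ext i j
  fin_cases i <;> fin_cases j <;> simp [sm] <;> ring

theorem sm_inj {a b c x y z a' b' c' x' y' z' : ℝ}
    (h : sm a b c x y z = sm a' b' c' x' y' z') :
    a = a' ∧ b = b' ∧ c = c' ∧ x = x' ∧ y = y' ∧ z = z' := by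
  have e : ∀ i j, _ := fun i j => congrFun (congrFun h i) j
  have e00 := e 0 0
  have e11 := e 1 1
  have e22 := e 2 2
  have e01 := e 0 1
  have e02 := e 0 2
  have e12 := e 1 2
  simp [sm] at e00 e11 e22 e01 e02 e12
  exact ⟨e00, e11, e22, e01, e02, e12⟩

theorem sm_zero : sm 0 0 0 0 0 0 = 0 := by
  ext i j
  fin_cases i <;> fin_cases j <;> simp [sm]

theorem mem_m_iff {X : Mat} :
    X ∈ m ↔ ∃ a b c x y z : ℝ, a + b + c = 0 ∧ X = sm a b c x y z := by
  constructor
  · rintro ⟨⟨h1, h2⟩, h3⟩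
    have hT : ∀ i j, X j i = X i j := fun i j => by
      have := congrFun (congrFun h3 i) j
      simpa [sigma] using this
    have hR : ∀ i j, (X i j).re = 0 := fun i j => by
      have := congrArg re (congrFun (congrFun h1 j) i)
      simp only [conjTranspose_apply, star_def, conj_re, Matrix.neg_apply, neg_re, hT i j] at this
      linarith
    have hX : ∀ i j, X i j = I * ((X i j).im : ℝ) := fun i j => by
      apply Complex.ext <;> simp [hR]
    refine ⟨(X 0 0).im, (X 1 1).im, (X 2 2).im, (X 0 1).im, (X 0 2).im, (X 1 2).im, ?_, ?_⟩
    · have := congrArg im h2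
      simpa [trace, Fin.sum_univ_three] using this
    · ext i j
      rw [hX i j]
      fin_cases i <;> fin_cases j <;> simp [sm, hT 0 1, hT 0 2, hT 1 2]
  · rintro ⟨a, b, c, x, y, z, h, rfl⟩
    refine ⟨⟨?_, ?_⟩, ?_⟩
    · ext i j
      fin_cases i <;> fin_cases j <;> simp [sm]
    · have h' : (a : ℂ) + b + c = 0 := by exact_mod_cast h
      simp only [sm, trace_smul, trace_fin_three]
      simp [h']
    · ext i j
      fin_cases i <;> fin_cases j <;> simp [sm, sigma]

theorem sm_mem_m {a b c x y z : ℝ} : sm a b c x y z ∈ m ↔ a + b + c = 0 := by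
  refine ⟨fun h => ?_, fun h => mem_m_iff.2 ⟨a, b, c, x, y, z, h, rfl⟩⟩
  obtain ⟨a', b', c', x', y', z', h', e⟩ := mem_m_iff.1 h
  obtain ⟨rfl, rfl, rfl, -⟩ := sm_inj e
  exact h'

theorem lie_sm_sm (a b c x y z a' b' c' x' y' z' : ℝ) :
    ⁅sm a b c x y z, sm a' b' c' x' y' z'⁆ =
      sk (-((a - b) * x' - (a' - b') * x + y * z' - y' * z))
        (-((a - c) * y' - (a' - c') * y + x * z' - x' * z))
        (-((b - c) * z' - (b' - c') * z + x * y' - x' * y)) := by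
  simp only [sm, Ring.lie_def, smul_mul_smul_comm, I_mul_I, ← smul_sub]
  ext i j
  fin_cases i <;> fin_cases j <;> simp [sk] <;> ring

theorem lie_sk_sm (u v w a b c x y z : ℝ) :
    ⁅sk u v w, sm a b c x y z⁆ =
      sm (2 * (u * x + v * y)) (2 * (w * z - u * x)) (-2 * (v * y + w * z))
        (u * (b - a) + v * z + w * y) (v * (c - a) + u * z - w * x)
        (w * (c - b) - u * y - v * x) := by
  simp only [sm, Ring.lie_def, Matrix.mul_smul, Matrix.smul_mul, ← smul_sub]
  congr 1
  ext i j
  fin_cases i <;> fin_cases j <;> simp [sk] <;> ring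

theorem curvature_sm (a b c x y z a' b' c' x' y' z' : ℝ) (C : Mat) :
    curvature (sm a b c x y z) (sm a' b' c' x' y' z') C =
      ⁅sk ((a - b) * x' - (a' - b') * x + y * z' - y' * z)
        ((a - c) * y' - (a' - c') * y + x * z' - x' * z)
        ((b - c) * z' - (b' - c') * z + x * y' - x' * y), C⁆ := by
  rw [curvature, lie_sm_sm, ← neg_lie]
  congr 1
  ext i j
  fin_cases i <;> fin_cases j <;> simp [sk]

theorem sk_eq_zero {u v w : ℝ} : sk u v w = 0 ↔ u = 0 ∧ v = 0 ∧ w = 0 := by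
  constructor
  · intro h
    have e : ∀ i j, _ := fun i j => congrFun (congrFun h i) j
    have e01 := e 0 1
    have e02 := e 0 2
    have e12 := e 1 2
    simp [sk] at e01 e02 e12
    exact ⟨e01, e02, e12⟩
  · rintro ⟨rfl, rfl, rfl⟩
    ext i j
    fin_cases i <;> fin_cases j <;> simp [sk]

/-! ### The standard Lie triple systems -/

/-- The space of diagonal matrices in `𝔪`. -/
def diagM : Submodule ℝ Mat where
  carrier := {X | X ∈ m ∧ ∀ i j, i ≠ j → X i j = 0}
  zero_mem' := ⟨m.zero_mem, fun _ _ _ => rfl⟩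
  add_mem' := fun hX hY =>
    ⟨m.add_mem hX.1 hY.1, fun i j h => by rw [Matrix.add_apply, hX.2 i j h, hY.2 i j h, add_zero]⟩
  smul_mem' := fun r X hX =>
    ⟨m.smul_mem r hX.1, fun i j h => by rw [Matrix.smul_apply, hX.2 i j h, smul_zero]⟩

theorem mem_diagM_iff {X : Mat} :
    X ∈ diagM ↔ ∃ a b c : ℝ, a + b + c = 0 ∧ X = sm a b c 0 0 0 := by
  constructor
  · rintro ⟨h, h'⟩
    obtain ⟨a, b, c, x, y, z, h0, rfl⟩ := mem_m_iff.1 h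
    have h01 := h' 0 1 (by decide)
    have h02 := h' 0 2 (by decide)
    have h12 := h' 1 2 (by decide)
    simp [sm] at h01 h02 h12
    subst h01 h02 h12
    exact ⟨a, b, c, h0, rfl⟩
  · rintro ⟨a, b, c, h0, rfl⟩
    refine ⟨sm_mem_m.2 h0, fun i j hij => ?_⟩
    fin_cases i <;> fin_cases j <;> simp [sm] at hij ⊢

theorem sm_mem_diagM {a b c : ℝ} (h : a + b + c = 0) : sm a b c 0 0 0 ∈ diagM :=
  mem_diagM_iff.2 ⟨a, b, c, h, rfl⟩

theorem diagM_le_m : diagM ≤ m := fun _ hX => hX.1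

theorem mem_span_sm_pair {X A B : Mat} :
    X ∈ Submodule.span ℝ {A, B} ↔ ∃ s t : ℝ, X = s • A + t • B := by
  simp only [Submodule.mem_span_pair, eq_comm]

/-- The standard Lie triple system of type (S). -/
noncomputable def stdS : Submodule ℝ Mat :=
  Submodule.span ℝ {sm 1 0 (-1) 0 0 0, sm 0 0 0 0 1 0}

/-- The standard Lie triple system of type (M) for `ε = 1`, and a congruent one for `ε = -1`. -/
noncomputable def stdM (ε : ℝ) : Submodule ℝ Mat :=
  Submodule.span ℝ {sm 1 0 (-1) 0 0 0, sm 0 0 0 1 0 ε}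

/-- The standard Lie triple system of type (P). -/
noncomputable def stdP : Submodule ℝ Mat := diagM ⊔ Submodule.span ℝ {sm 0 0 0 0 1 0}

theorem mem_stdS_iff {X : Mat} : X ∈ stdS ↔ ∃ s t : ℝ, X = sm s 0 (-s) 0 t 0 := by
  simp [stdS, mem_span_sm_pair, smul_sm, sm_add]

theorem mem_stdM_iff {ε : ℝ} {X : Mat} :
    X ∈ stdM ε ↔ ∃ s t : ℝ, X = sm s 0 (-s) t 0 (t * ε) := by
  simp [stdM, mem_span_sm_pair, smul_sm, sm_add]

theorem mem_stdP_iff {X : Mat} :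
    X ∈ stdP ↔ ∃ a b c t : ℝ, a + b + c = 0 ∧ X = sm a b c 0 t 0 := by
  simp only [stdP, Submodule.mem_sup, mem_diagM_iff, Submodule.mem_span_singleton]
  constructor
  · rintro ⟨_, ⟨a, b, c, h, rfl⟩, _, ⟨t, rfl⟩, rfl⟩
    exact ⟨a, b, c, t, h, by simp [smul_sm, sm_add]⟩
  · rintro ⟨a, b, c, t, h, rfl⟩
    exact ⟨_, ⟨a, b, c, h, rfl⟩, _, ⟨t, rfl⟩, by simp [smul_sm, sm_add]⟩

/-- `V` is the standard subspace of type `τ`, with the sign `ε` for the type (M) (unique unless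
`τ = .G`). -/
def IsStd (ε : ℝ) : LTSType → Submodule ℝ Mat → Prop
  | .G, V => ∃ H ∈ diagM, H ≠ 0 ∧ V = Submodule.span ℝ {H}
  | .T, V => V = diagM
  | .S, V => V = stdS
  | .M, V => V = stdM ε
  | .P, V => V = stdP

theorem isLieTripleSystem_of_isFlat {U : Submodule ℝ Mat} (h : IsFlat U) :
    IsLieTripleSystem U :=
  ⟨h.1, fun u hu v hv w hw => by rw [h.2 u hu v hv w hw]; exact U.zero_mem⟩

theorem isFlat_diagM : IsFlat diagM := by
  refine isFlat_iff.2 ⟨diagM_le_m, fun u hu v hv => ?_⟩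
  obtain ⟨a, b, c, -, rfl⟩ := mem_diagM_iff.1 hu
  obtain ⟨a', b', c', -, rfl⟩ := mem_diagM_iff.1 hv
  simp [lie_sm_sm, sk_eq_zero]

theorem IsFlat.mono {a b : Submodule ℝ Mat} (hb : IsFlat b) (h : a ≤ b) : IsFlat a :=
  ⟨h.trans hb.1, fun u hu v hv w hw => hb.2 u (h hu) v (h hv) w (h hw)⟩

theorem isLieTripleSystem_stdS : IsLieTripleSystem stdS := by
  refine ⟨fun X hX => ?_, fun u hu v hv w hw => ?_⟩
  · obtain ⟨s, t, rfl⟩ := mem_stdS_iff.1 hX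
    exact sm_mem_m.2 (by ring)
  · obtain ⟨s, t, rfl⟩ := mem_stdS_iff.1 hu
    obtain ⟨s', t', rfl⟩ := mem_stdS_iff.1 hv
    obtain ⟨s'', t'', rfl⟩ := mem_stdS_iff.1 hw
    rw [curvature_sm, lie_sk_sm, mem_stdS_iff]
    refine ⟨2 * (((s - -s) * t' - (s' - -s') * t) * t''),
      ((s - -s) * t' - (s' - -s') * t) * (-s'' - s''), ?_⟩
    congr 1 <;> ring

theorem isLieTripleSystem_stdM : IsLieTripleSystem (stdM 1) := by
  refine ⟨fun X hX => ?_, fun u hu v hv w hw => ?_⟩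
  · obtain ⟨s, t, rfl⟩ := mem_stdM_iff.1 hX
    exact sm_mem_m.2 (by ring)
  · obtain ⟨s, t, rfl⟩ := mem_stdM_iff.1 hu
    obtain ⟨s', t', rfl⟩ := mem_stdM_iff.1 hv
    obtain ⟨s'', t'', rfl⟩ := mem_stdM_iff.1 hw
    rw [curvature_sm, lie_sk_sm, mem_stdM_iff]
    refine ⟨2 * ((s * t' - s' * t) * t''), -(s * t' - s' * t) * s'', ?_⟩
    congr 1 <;> ring

theorem isLieTripleSystem_stdP : IsLieTripleSystem stdP := by
  refine ⟨fun X hX => ?_, fun u hu v hv w hw => ?_⟩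
  · obtain ⟨a, b, c, t, h, rfl⟩ := mem_stdP_iff.1 hX
    exact sm_mem_m.2 h
  · obtain ⟨a, b, c, t, h, rfl⟩ := mem_stdP_iff.1 hu
    obtain ⟨a', b', c', t', h', rfl⟩ := mem_stdP_iff.1 hv
    obtain ⟨a'', b'', c'', t'', h'', rfl⟩ := mem_stdP_iff.1 hw
    rw [curvature_sm, lie_sk_sm, mem_stdP_iff]
    refine ⟨2 * (((a - c) * t' - (a' - c') * t) * t''), 0,
      -2 * (((a - c) * t' - (a' - c') * t) * t''),
      ((a - c) * t' - (a' - c') * t) * (c'' - a''), by ring, ?_⟩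
    congr 1 <;> ring

theorem IsStd.isLieTripleSystem {τ : LTSType} {V : Submodule ℝ Mat} (h : IsStd 1 τ V) :
    IsLieTripleSystem V := by
  cases τ with
  | G =>
    obtain ⟨H, hH, -, rfl⟩ := h
    exact isLieTripleSystem_of_isFlat
      (isFlat_diagM.mono ((Submodule.span_singleton_le_iff_mem _ _).2 hH))
  | T => exact h ▸ isLieTripleSystem_of_isFlat isFlat_diagM
  | S => exact h ▸ isLieTripleSystem_stdS
  | M => exact h ▸ isLieTripleSystem_stdM
  | P => exact h ▸ isLieTripleSystem_stdP

/-! ### Weight decomposition under the rotations about the first axis -/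

section Weights

variable {U : Submodule ℝ Mat}

/-- Invariance under the infinitesimal rotation about the first axis. -/
def IsRotInvariant (U : Submodule ℝ Mat) : Prop := ∀ w ∈ U, ⁅sk 0 0 1, w⁆ ∈ U

theorem IsRotInvariant.sm_mem (hJ : IsRotInvariant U) {a b c x y z : ℝ}
    (h : sm a b c x y z ∈ U) : sm 0 (2 * z) (-2 * z) y (-x) (c - b) ∈ U := by
  have := hJ _ h
  rw [lie_sk_sm] at this
  convert this using 1
  congr 1 <;> ring

/-- Elements of an invariant subspace decompose into weight vectors of the subspace. -/
theorem IsRotInvariant.weight_mem (hJ : IsRotInvariant U) {a b c x y z : ℝ}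
    (h0 : a + b + c = 0) (h : sm a b c x y z ∈ U) :
    sm a (-a / 2) (-a / 2) 0 0 0 ∈ U ∧ sm 0 0 0 x y 0 ∈ U ∧
      sm 0 ((b - c) / 2) (-(b - c) / 2) 0 0 z ∈ U := by
  -- Let `J` be the bracket with `sk 0 0 1`. Then `J²` acts as `0, -1, -4` on the weights 0, 1, 2,
  -- so `(J⁴ + J²) / 12` projects onto weight 2, and `-J²` minus four times this projects onto
  -- weight 1.
  have h2 := hJ.sm_mem (hJ.sm_mem h)
  have h4 := hJ.sm_mem (hJ.sm_mem h2)
  have w2 := U.smul_mem (1 / 12 : ℝ) (U.add_mem h4 h2)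
  have w1 := U.sub_mem (U.smul_mem (-1 : ℝ) h2) (U.smul_mem (4 : ℝ) w2)
  have w0 := U.sub_mem (U.sub_mem h w2) w1
  simp only [sub_eq_add_neg, ← neg_one_smul ℝ (sm _ _ _ _ _ _), smul_sm, sm_add] at w0 w1 w2
  refine ⟨?_, ?_, ?_⟩
  · convert w0 using 1
    congr 1 <;> linarith
  · convert w1 using 1
    congr 1 <;> ring
  · convert w2 using 1
    congr 1 <;> ring

theorem IsRotInvariant.weight_zero_mem (hJ : IsRotInvariant U) {a b c x y z : ℝ}
    (h0 : a + b + c = 0) (h : sm a b c x y z ∈ U) (ha : a ≠ 0) : sm (-2) 1 1 0 0 0 ∈ U := by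
  have := U.smul_mem (-2 / a) (hJ.weight_mem h0 h).1
  rw [smul_sm] at this
  convert this using 1
  congr 1 <;> field_simp <;> norm_num

theorem IsRotInvariant.weight_one_mem (hJ : IsRotInvariant U) {a b c x y z : ℝ}
    (h0 : a + b + c = 0) (h : sm a b c x y z ∈ U) (hxy : x ≠ 0 ∨ y ≠ 0) (s t : ℝ) :
    sm 0 0 0 s t 0 ∈ U := by
  have hn : x ^ 2 + y ^ 2 ≠ 0 := by
    rcases hxy with h | h <;> positivity
  have h1 := (hJ.weight_mem h0 h).2.1
  have h2 := hJ.sm_mem h1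
  -- A non-zero vector `(x, y)` and its image `(y, -x)` form an orthogonal basis of the weight
  -- space; the coefficients are those of `(s, t)` in this basis.
  have := U.add_mem (U.smul_mem ((s * x + t * y) / (x ^ 2 + y ^ 2)) h1)
    (U.smul_mem ((s * y - t * x) / (x ^ 2 + y ^ 2)) h2)
  rw [smul_sm, smul_sm, sm_add] at this
  convert this using 1
  congr 1 <;> field_simp <;> ring

theorem IsRotInvariant.weight_two_mem (hJ : IsRotInvariant U) {a b c x y z : ℝ}
    (h0 : a + b + c = 0) (h : sm a b c x y z ∈ U) (hbc : b ≠ c ∨ z ≠ 0) (s t : ℝ) :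
    sm 0 s (-s) 0 0 t ∈ U := by
  have hn : (b - c) ^ 2 + 4 * z ^ 2 ≠ 0 := by
    rcases hbc with h | h
    · have := sub_ne_zero.2 h
      positivity
    · positivity
  have h1 := (hJ.weight_mem h0 h).2.2
  have h2 := hJ.sm_mem h1
  have := U.add_mem (U.smul_mem ((2 * s * (b - c) + 4 * t * z) / ((b - c) ^ 2 + 4 * z ^ 2)) h1)
    (U.smul_mem ((2 * s * z - t * (b - c)) / ((b - c) ^ 2 + 4 * z ^ 2)) h2)
  rw [smul_sm, smul_sm, sm_add] at this
  convert this using 1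
  congr 1 <;> field_simp <;> ring

/-- The Lie triple systems which are not flat and on which a rotation about the first axis acts. -/
theorem IsRotInvariant.classification (hJ : IsRotInvariant U) (hU : IsLieTripleSystem U)
    (hm : U ≠ m) (hne : ∃ u ∈ U, ∃ v ∈ U, ⁅u, v⁆ ≠ 0) :
    (∀ X, X ∈ U ↔ ∃ x y : ℝ, X = sm 0 0 0 x y 0) ∨
    (∀ X, X ∈ U ↔ ∃ s z : ℝ, X = sm 0 s (-s) 0 0 z) ∨
    (∀ X, X ∈ U ↔ ∃ a b c z : ℝ, a + b + c = 0 ∧ X = sm a b c 0 0 z) := by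
  have hcoord : ∀ X ∈ U, ∃ a b c x y z : ℝ, a + b + c = 0 ∧ X = sm a b c x y z :=
    fun X hX => mem_m_iff.1 (hU.1 hX)
  by_cases p1 : ∀ s t : ℝ, sm 0 0 0 s t 0 ∈ U
  -- For a diagonal `D` and the weight 1 vector `e` with `x = 1`, `R(D, e)e` is a multiple of
  -- `diag(1, -1, 0)`, which has components of both weights 0 and 2. So either of these weights
  -- brings in the other, and `U` would be all of `𝔪`.
  · have hdiag : ∀ b c : ℝ, sm (b + c) (-b) (-c) 0 0 0 ∈ U →
        2 * b + c ≠ 0 → sm 1 (-1) 0 0 0 0 ∈ U := by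
      intro b c h hbc
      have := hU.2 _ h _ (p1 1 0) _ (p1 1 0)
      rw [curvature_sm, lie_sk_sm] at this
      have := U.smul_mem (1 / (2 * (2 * b + c))) this
      rw [smul_sm] at this
      convert this using 1
      congr 1 <;> field_simp <;> ring
    have hfull : sm (-2) 1 1 0 0 0 ∈ U → (∀ s t : ℝ, sm 0 s (-s) 0 0 t ∈ U) → False := by
      intro h0 h2
      refine hm (le_antisymm hU.1 fun X hX => ?_)
      obtain ⟨a, b, c, x, y, z, h, rfl⟩ := mem_m_iff.1 hX
      have := U.add_mem (U.add_mem (U.smul_mem (-a / 2) h0) (p1 x y)) (h2 ((b - c) / 2) z)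
      rw [smul_sm, sm_add, sm_add] at this
      convert this using 1
      congr 1 <;> linarith
    have hU0 : ∀ X ∈ U, ∃ x y : ℝ, X = sm 0 0 0 x y 0 := by
      intro X hX
      obtain ⟨a, b, c, x, y, z, h, rfl⟩ := hcoord X hX
      have ha : a = 0 := by
        by_contra ha
        have h0 := hJ.weight_zero_mem h hX ha
        have h1 := hdiag (-1) (-1) (by convert h0 using 1; congr 1 <;> norm_num)
          (by norm_num)
        exact hfull h0 (hJ.weight_two_mem (by norm_num) h1 (by norm_num))
      have h2 : ¬ (b ≠ c ∨ z ≠ 0) := by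
        intro h2
        have h0 := hJ.weight_two_mem h hX h2
        have h1 := hdiag (-1) 1 (by convert h0 1 0 using 1; congr 1 <;> norm_num)
          (by norm_num)
        exact hfull (hJ.weight_zero_mem (by norm_num) h1 (by norm_num)) h0
      push Not at h2
      obtain ⟨hb, rfl⟩ := h2
      have hb0 : b = 0 := by linarith
      have hc0 : c = 0 := by linarith
      subst ha hb0 hc0
      exact ⟨x, y, rfl⟩
    left
    intro X
    refine ⟨hU0 X, ?_⟩
    rintro ⟨x, y, rfl⟩
    exact p1 x y
  · have hU1 : ∀ X ∈ U, ∃ a b c z : ℝ, a + b + c = 0 ∧ X = sm a b c 0 0 z := by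
      intro X hX
      obtain ⟨a, b, c, x, y, z, h, rfl⟩ := hcoord X hX
      have h1 : ¬ (x ≠ 0 ∨ y ≠ 0) := fun h1 => p1 (hJ.weight_one_mem h hX h1)
      push Not at h1
      obtain ⟨rfl, rfl⟩ := h1
      exact ⟨a, b, c, z, h, rfl⟩
    -- Without weight 2 all elements of `U` would be diagonal, hence commute.
    have p2 : ∀ s t : ℝ, sm 0 s (-s) 0 0 t ∈ U := by
      by_contra p2
      have key : ∀ X ∈ U, ∃ a b c : ℝ, X = sm a b c 0 0 0 := by
        intro X hX
        obtain ⟨a, b, c, z, h, rfl⟩ := hU1 X hX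
        by_cases hz : z = 0
        · exact ⟨a, b, c, by rw [hz]⟩
        · exact absurd (hJ.weight_two_mem h hX (Or.inr hz)) p2
      obtain ⟨u, hu, v, hv, huv⟩ := hne
      obtain ⟨a, b, c, rfl⟩ := key u hu
      obtain ⟨a', b', c', rfl⟩ := key v hv
      exact huv (by simp [lie_sm_sm, sk_eq_zero])
    right
    by_cases p0 : sm (-2) 1 1 0 0 0 ∈ U
    · right
      intro X
      refine ⟨hU1 X, ?_⟩
      rintro ⟨a, b, c, z, h, rfl⟩
      have := U.add_mem (U.smul_mem (-a / 2) p0) (p2 ((b - c) / 2) z)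
      rw [smul_sm, sm_add] at this
      convert this using 1
      congr 1 <;> linarith
    · left
      intro X
      constructor
      · intro hX
        obtain ⟨a, b, c, z, h, rfl⟩ := hU1 X hX
        have ha : a = 0 := by
          by_contra ha
          exact p0 (hJ.weight_zero_mem h hX ha)
        refine ⟨b, z, ?_⟩
        congr 1
        linarith
      · rintro ⟨s, z, rfl⟩
        exact p2 s z

end Weights

/-! ### Conjugation into normal position -/

/-- The matrix `i · diag(d)`. -/
theorem sm_diagonal (d : Fin 3 → ℝ) :
    sm (d 0) (d 1) (d 2) 0 0 0 = I • (diagonal d).map ofReal := by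
  ext i j
  fin_cases i <;> fin_cases j <;> simp [sm]

theorem sm_eq_smul_map (a b c x y z : ℝ) :
    sm a b c x y z = I • (!![a, x, y; x, b, z; y, z, c]).map ofReal := by
  ext i j
  fin_cases i <;> fin_cases j <;> simp [sm]

theorem sk_eq_map (u v w : ℝ) :
    sk u v w = (!![0, u, v; -u, 0, w; -v, -w, 0]).map ofReal := by
  ext i j
  fin_cases i <;> fin_cases j <;> simp [sk]

theorem map_ofReal_mul (A B : Matrix (Fin 3) (Fin 3) ℝ) :
    ((A * B).map ofReal : Mat) = A.map ofReal * B.map ofReal := by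
  ext i j
  simp [mul_apply]

theorem map_ofReal_injective :
    Function.Injective fun A : Matrix (Fin 3) (Fin 3) ℝ => (A.map ofReal : Mat) :=
  Matrix.map_injective ofReal_injective

theorem isotropy_map_ofReal (k : SO3) (A : Matrix (Fin 3) (Fin 3) ℝ) :
    isotropy k (A.map ofReal) = ((k : Matrix (Fin 3) (Fin 3) ℝ) * A *
      (k : Matrix (Fin 3) (Fin 3) ℝ)ᵀ).map ofReal := by
  rw [isotropy_apply, map_ofReal_mul, map_ofReal_mul]
  rfl

theorem mem_m_iff_map {X : Mat} :
    X ∈ m ↔ ∃ A : Matrix (Fin 3) (Fin 3) ℝ, Aᵀ = A ∧ A.trace = 0 ∧ X = I • A.map ofReal := by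
  rw [mem_m_iff]
  constructor
  · rintro ⟨a, b, c, x, y, z, h, rfl⟩
    refine ⟨_, ?_, ?_, sm_eq_smul_map a b c x y z⟩
    · ext i j
      fin_cases i <;> fin_cases j <;> rfl
    · simpa [trace, Fin.sum_univ_three] using h
  · rintro ⟨A, hA, htr, rfl⟩
    have hT : ∀ i j, A j i = A i j := fun i j => congrFun (congrFun hA i) j
    refine ⟨A 0 0, A 1 1, A 2 2, A 0 1, A 0 2, A 1 2, ?_, ?_⟩
    · simpa [trace, Fin.sum_univ_three] using htr
    · ext i j
      fin_cases i <;> fin_cases j <;> simp [sm, hT 0 1, hT 0 2, hT 1 2]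

/-- A flat subspace is conjugate to a space of diagonal matrices; one of its elements can be
brought into decreasing order. -/
theorem IsFlat.exists_diagonal {a : Submodule ℝ Mat} (ha : IsFlat a) {H : Mat} (hH : H ∈ a) :
    ∃ k : SO3, a ≤ diagM.map (isotropy k) ∧
      ∃ d : Fin 3 → ℝ, Antitone d ∧ isotropy k⁻¹ H = sm (d 0) (d 1) (d 2) 0 0 0 := by
  have hex : ∀ X : a, ∃ A : Matrix (Fin 3) (Fin 3) ℝ, Aᵀ = A ∧ A.trace = 0 ∧
      (X : Mat) = I • A.map ofReal := fun X => mem_m_iff_map.1 (ha.1 X.2)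
  choose A hA htr hX using hex
  have hC : ∀ X Y, A X * A Y = A Y * A X := by
    intro X Y
    have h := lie_eq_zero_of_isFlat ha X.2 Y.2
    rw [hX X, hX Y, Ring.lie_def, smul_mul_smul_comm, smul_mul_smul_comm, I_mul_I, ← smul_sub,
      smul_eq_zero, or_iff_right (by norm_num), sub_eq_zero, ← map_ofReal_mul,
      ← map_ofReal_mul] at h
    exact map_ofReal_injective h
  obtain ⟨k, d, hd, hanti⟩ := exists_SO3_diagonal A hA hC ⟨H, hH⟩
  have hk : ∀ X (h : X ∈ a), isotropy k⁻¹ X =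
      sm (d ⟨X, h⟩ 0) (d ⟨X, h⟩ 1) (d ⟨X, h⟩ 2) 0 0 0 := by
    intro X h
    apply isotropy_injective k
    rw [isotropy_apply_inv, sm_diagonal, isotropy_smul, isotropy_map_ofReal, ← hd, ← hX]
  refine ⟨k, fun X h => ?_, d ⟨H, hH⟩, hanti, hk H hH⟩
  have hm := isotropy_mem_m k⁻¹ (ha.1 h)
  rw [mem_map_isotropy]
  rw [hk X h] at hm ⊢
  exact sm_mem_diagM (sm_mem_m.1 hm)

/-- A real skew-symmetric matrix is conjugate to an infinitesimal rotation about the first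
axis. -/
theorem exists_isotropy_sk (u v w : ℝ) : ∃ (k : SO3) (l : ℝ),
    isotropy k (sk u v w) = l • sk 0 0 1 := by
  set K : Matrix (Fin 3) (Fin 3) ℝ := !![0, u, v; -u, 0, w; -v, -w, 0] with hK
  have hKT : Kᵀ = -K := by
    ext i j
    fin_cases i <;> fin_cases j <;> simp [hK]
  -- The symmetric matrix `K²` is diagonalised instead of `K`. Then `L = Qᵀ K Q` is skew with
  -- diagonal square, so the product of any two of its entries above the diagonal vanishes. As `K²`
  -- is negative semidefinite, decreasing order puts the eigenvalue 0 first, which makes the first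
  -- axis the axis of rotation.
  obtain ⟨k, d, hd, hanti⟩ := exists_SO3_diagonal (fun _ : Unit => K * K)
    (fun _ => by rw [transpose_mul, hKT, neg_mul_neg]) (fun _ _ => rfl) ()
  set Q := (k : Matrix (Fin 3) (Fin 3) ℝ)
  have hQ : Q * Qᵀ = 1 := (mem_orthogonalGroup_iff _ _).1 (mem_specialOrthogonalGroup_iff.1 k.2).1
  have hQ' : Qᵀ * Q = 1 := mul_eq_one_comm.1 hQ
  set L := Qᵀ * K * Q with hL
  have hLT : Lᵀ = -L := by
    rw [hL, transpose_mul, transpose_mul, hKT, transpose_transpose]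
    simp [mul_assoc]
  have hLL : L * L = diagonal (d ()) := by
    calc L * L = Qᵀ * K * (Q * Qᵀ) * K * Q := by simp only [hL, mul_assoc]
      _ = Qᵀ * (K * K) * Q := by rw [hQ]; simp only [mul_assoc, one_mul]
      _ = (Qᵀ * Q) * diagonal (d ()) * (Qᵀ * Q) := by rw [hd ()]; simp only [mul_assoc]
      _ = _ := by rw [hQ', one_mul, mul_one]
  have hS : ∀ i j, L j i = -L i j := fun i j => congrFun (congrFun hLT i) j
  have hdg : ∀ i, L i i = 0 := fun i => by linarith [hS i i]
  have e : ∀ i j, (L * L) i j = diagonal (d ()) i j := fun i j => by rw [hLL]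
  have e01 := e 0 1
  have e02 := e 0 2
  have e12 := e 1 2
  have e00 := e 0 0
  have e11 := e 1 1
  have e22 := e 2 2
  simp [mul_apply, Fin.sum_univ_three, hdg, hS 0 1, hS 0 2, hS 1 2] at e01 e02 e12 e00 e11 e22
  have a01 : d () 1 ≤ d () 0 := hanti (by decide)
  have a12 : d () 2 ≤ d () 1 := hanti (by decide)
  have h01 : L 0 1 = 0 := by
    by_contra h
    have h02 : L 0 2 = 0 := by simpa [h] using e12
    have h12 : L 1 2 = 0 := by simpa [h] using e02
    have := mul_self_pos.2 h
    nlinarith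
  have h02 : L 0 2 = 0 := by
    by_contra h
    have h12 : L 1 2 = 0 := by simpa [h] using e01
    have := mul_self_pos.2 h
    rw [h01, h12] at e11
    rw [h01] at e00
    nlinarith
  refine ⟨k⁻¹, L 1 2, ?_⟩
  have hinv : ((k⁻¹ : SO3) : Matrix (Fin 3) (Fin 3) ℝ) = Qᵀ := rfl
  rw [sk_eq_map, isotropy_map_ofReal, hinv, transpose_transpose, ← hK, ← hL]
  ext i j
  fin_cases i <;> fin_cases j <;> simp [sk, hdg, hS 0 1, hS 0 2, hS 1 2, h01, h02]

/-- The element of `SO(3)` given by a matrix. -/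
def mkSO3 (Q : Matrix (Fin 3) (Fin 3) ℝ) (hQ : Q * Qᵀ = 1) (hd : Q.det = 1) : SO3 :=
  ⟨Q, mem_specialOrthogonalGroup_iff.2 ⟨(mem_orthogonalGroup_iff _ _).2 hQ, hd⟩⟩

theorem isotropy_mkSO3 {Q : Matrix (Fin 3) (Fin 3) ℝ} (hQ : Q * Qᵀ = 1) (hd : Q.det = 1)
    (a b c x y z : ℝ) :
    isotropy (mkSO3 Q hQ hd) (sm a b c x y z) =
      I • (Q * !![a, x, y; x, b, z; y, z, c] * Qᵀ).map ofReal := by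
  rw [sm_eq_smul_map, isotropy_smul, isotropy_map_ofReal]
  rfl

/-- Exchanging the first two axes carries the weight 2 space to `stdS`, and weights 0 and 2 together
to `stdP`. The third axis is reversed to keep the determinant equal to 1. -/
theorem exists_isotropy_swap : ∃ k : SO3, ∀ a b c x y z : ℝ,
    isotropy k (sm a b c x y z) = sm b a c x (-z) (-y) := by
  have hQ : (!![0, 1, 0; 1, 0, 0; 0, 0, -1] : Matrix (Fin 3) (Fin 3) ℝ) *
      !![0, 1, 0; 1, 0, 0; 0, 0, -1]ᵀ = 1 := by
    ext i j
    fin_cases i <;> fin_cases j <;> simp [mul_apply, Fin.sum_univ_three]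
  refine ⟨mkSO3 _ hQ (by simp [det_fin_three]), fun a b c x y z => ?_⟩
  rw [isotropy_mkSO3, sm_eq_smul_map]
  congr 2
  ext i j
  fin_cases i <;> fin_cases j <;> simp [mul_apply, Fin.sum_univ_three]

/-- The half turn about the first axis, which interchanges `stdM 1` and `stdM (-1)`. -/
theorem exists_isotropy_sign : ∃ k : SO3, ∀ a b c x y z : ℝ,
    isotropy k (sm a b c x y z) = sm a b c (-x) (-y) z := by
  have hQ : (!![1, 0, 0; 0, -1, 0; 0, 0, -1] : Matrix (Fin 3) (Fin 3) ℝ) *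
      !![1, 0, 0; 0, -1, 0; 0, 0, -1]ᵀ = 1 := by
    ext i j
    fin_cases i <;> fin_cases j <;> simp [mul_apply, Fin.sum_univ_three]
  refine ⟨mkSO3 _ hQ (by simp [det_fin_three]), fun a b c x y z => ?_⟩
  rw [isotropy_mkSO3, sm_eq_smul_map]
  congr 2
  ext i j
  fin_cases i <;> fin_cases j <;> simp [mul_apply, Fin.sum_univ_three]

/-- Turning by `π / 4` in the plane of the first and third axes, with `s² = 1/2`, carries the weight
1 space onto `stdM 1`. -/
theorem exists_isotropy_rotation : ∃ (k : SO3) (s : ℝ), s ≠ 0 ∧ ∀ x y : ℝ,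
    isotropy k (sm 0 0 0 x y 0) = sm (-y) 0 y (s * x) 0 (s * x) := by
  obtain ⟨s, hs⟩ : ∃ s : ℝ, s * s = 1 / 2 := ⟨√(1 / 2), Real.mul_self_sqrt (by norm_num)⟩
  have hQ : (!![s, 0, -s; 0, 1, 0; s, 0, s] : Matrix (Fin 3) (Fin 3) ℝ) *
      !![s, 0, -s; 0, 1, 0; s, 0, s]ᵀ = 1 := by
    ext i j
    fin_cases i <;> fin_cases j <;> simp [mul_apply, Fin.sum_univ_three] <;> linarith
  refine ⟨mkSO3 _ hQ ?_, s, ?_, fun x y => ?_⟩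
  · simp [det_fin_three]
    linarith
  · rintro rfl
    norm_num at hs
  · rw [isotropy_mkSO3, sm_eq_smul_map]
    congr 2
    ext i j
    fin_cases i <;> fin_cases j <;> simp [mul_apply, Fin.sum_univ_three] <;>
      first | ring1 | linear_combination (2 * y) * hs | linear_combination (-2 * y) * hs

theorem exists_map_isotropy_stdM {ε : ℝ} (hε : ε = 1 ∨ ε = -1) :
    ∃ k : SO3, (stdM ε).map (isotropy k) = stdM 1 := by
  rcases hε with rfl | rfl
  · exact ⟨1, map_isotropy_one _⟩
  · obtain ⟨k, hk⟩ := exists_isotropy_sign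
    refine ⟨k, ?_⟩
    rw [stdM, Submodule.map_span, Set.image_pair, hk, hk]
    ext X
    simp only [mem_span_sm_pair, mem_stdM_iff, smul_sm, sm_add]
    constructor
    · rintro ⟨s, t, rfl⟩
      exact ⟨s, -t, by congr 1 <;> ring⟩
    · rintro ⟨s, t, rfl⟩
      exact ⟨s, -t, by congr 1 <;> ring⟩

theorem finrank_diagM_le : Module.finrank ℝ diagM ≤ 2 := by
  have h : diagM = Submodule.span ℝ {sm 1 0 (-1) 0 0 0, sm 0 1 (-1) 0 0 0} := by
    ext X
    simp only [mem_span_sm_pair, mem_diagM_iff, smul_sm, sm_add]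
    constructor
    · rintro ⟨a, b, c, h, rfl⟩
      refine ⟨a, b, ?_⟩
      congr 1 <;> linarith
    · rintro ⟨s, t, rfl⟩
      exact ⟨s, t, -s - t, by ring, by congr 1 <;> ring⟩
  classical
  rw [h, ← Finset.coe_pair]
  exact (finrank_span_finset_le_card _).trans Finset.card_le_two

/-! ### Classification up to congruence -/

theorem classification {U : Submodule ℝ Mat} (hU : IsLieTripleSystem U) (h0 : U ≠ ⊥)
    (hm : U ≠ m) : ∃ (τ : LTSType) (k : SO3) (V : Submodule ℝ Mat),
      IsStd 1 τ V ∧ U = V.map (isotropy k) := by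
  by_cases hab : ∀ u ∈ U, ∀ v ∈ U, ⁅u, v⁆ = 0
  -- No order of eigenvalues is needed here, so the element to be sorted is just `0`.
  · obtain ⟨k, hk, -⟩ := (isFlat_iff.2 ⟨hU.1, hab⟩).exists_diagonal U.zero_mem
    obtain ⟨V, hV, rfl⟩ : ∃ V ≤ diagM, V.map (isotropy k) = U := by
      refine ⟨U.map (isotropy k⁻¹), ?_, map_isotropy_map_inv k U⟩
      rw [← map_isotropy_inv_map k diagM]
      exact Submodule.map_mono hk
    have hle := (Submodule.finrank_mono hV).trans finrank_diagM_le
    have h0' : Module.finrank ℝ V ≠ 0 := fun h => h0 (by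
      rw [Submodule.finrank_eq_zero.1 h, Submodule.map_bot])
    obtain h1 | h2 : Module.finrank ℝ V = 1 ∨ Module.finrank ℝ V = 2 := by omega
    · obtain ⟨⟨H, hH⟩, hne, hspan⟩ := finrank_eq_one_iff'.1 h1
      refine ⟨.G, k, V, ⟨H, hV hH, fun h => hne (Subtype.ext h), ?_⟩, rfl⟩
      refine le_antisymm (fun X hX => ?_) ((Submodule.span_singleton_le_iff_mem _ _).2 hH)
      obtain ⟨r, hr⟩ := hspan ⟨X, hX⟩
      exact Submodule.mem_span_singleton.2 ⟨r, congrArg Subtype.val hr⟩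
    · exact ⟨.T, k, V, Submodule.eq_of_le_of_finrank_le hV (h2 ▸ finrank_diagM_le), rfl⟩
  · push Not at hab
    obtain ⟨u, hu, v, hv, huv⟩ := hab
    obtain ⟨p, q, r, hK⟩ : ∃ p q r : ℝ, ⁅u, v⁆ = sk p q r := by
      obtain ⟨a, b, c, x, y, z, -, rfl⟩ := mem_m_iff.1 (hU.1 hu)
      obtain ⟨a', b', c', x', y', z', -, rfl⟩ := mem_m_iff.1 (hU.1 hv)
      exact ⟨_, _, _, lie_sm_sm _ _ _ _ _ _ _ _ _ _ _ _⟩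
    obtain ⟨k, l, hk⟩ := exists_isotropy_sk p q r
    have hl : l ≠ 0 := by
      rintro rfl
      rw [← hK, zero_smul] at hk
      exact huv (isotropy_injective k (by rw [hk, map_zero]))
    set W := U.map (isotropy k) with hW
    have hUW : U = W.map (isotropy k⁻¹) := (map_isotropy_inv_map k U).symm
    have hWL : IsLieTripleSystem W := hU.map_isotropy k
    have hWm : W ≠ m := fun h => hm (by rw [hUW, h, map_isotropy_m])
    have hWab : ∃ u ∈ W, ∃ v ∈ W, ⁅u, v⁆ ≠ 0 := by
      refine ⟨_, Submodule.mem_map_of_mem hu, _, Submodule.mem_map_of_mem hv, fun h => huv ?_⟩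
      rw [← isotropy_lie] at h
      exact isotropy_injective k (by rw [h, map_zero])
    -- Up to the factor `-l`, the rotation acts on `W` as the curvature operator of the images of
    -- `u` and `v`.
    have hrot : IsRotInvariant W := by
      intro w hw
      have h := hWL.2 _ (Submodule.mem_map_of_mem hu) _ (Submodule.mem_map_of_mem hv) _ hw
      rw [curvature, ← isotropy_lie, hK, hk, smul_lie] at h
      have := W.smul_mem l⁻¹ (W.neg_mem h)
      rwa [neg_neg, inv_smul_smul₀ hl] at this
    have key : ∀ (τ : LTSType) (V : Submodule ℝ Mat), IsStd 1 τ V →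
        (∃ j : SO3, ∀ X, X ∈ W ↔ isotropy j X ∈ V) →
        ∃ (τ : LTSType) (k : SO3) (V : Submodule ℝ Mat),
          IsStd 1 τ V ∧ U = V.map (isotropy k) := by
      rintro τ V hV ⟨j, hj⟩
      refine ⟨τ, k⁻¹ * j⁻¹, V, hV, ?_⟩
      rw [hUW, ← map_isotropy_map_isotropy]
      congr 1
      ext X
      rw [hj, mem_map_isotropy, inv_inv]
    rcases hrot.classification hWL hWm hWab with h | h | h
    · obtain ⟨j, s, hs, hj⟩ := exists_isotropy_rotation
      refine key .M (stdM 1) rfl ⟨j, fun X => ?_⟩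
      rw [h, mem_stdM_iff]
      constructor
      · rintro ⟨x, y, rfl⟩
        exact ⟨-y, s * x, by rw [hj]; congr 1 <;> ring⟩
      · rintro ⟨a, b, hX⟩
        refine ⟨b / s, -a, isotropy_injective j ?_⟩
        rw [hX, hj]
        congr 1 <;> field_simp
    · obtain ⟨j, hj⟩ := exists_isotropy_swap
      refine key .S stdS rfl ⟨j, fun X => ?_⟩
      rw [h, mem_stdS_iff]
      constructor
      · rintro ⟨s, z, rfl⟩
        exact ⟨s, -z, by rw [hj]; congr 1; ring⟩
      · rintro ⟨s, t, hX⟩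
        refine ⟨s, -t, isotropy_injective j ?_⟩
        rw [hX, hj]
        congr 1 <;> ring
    · obtain ⟨j, hj⟩ := exists_isotropy_swap
      refine key .P stdP rfl ⟨j, fun X => ?_⟩
      rw [h, mem_stdP_iff]
      constructor
      · rintro ⟨a, b, c, z, h0, rfl⟩
        exact ⟨b, a, c, -z, by linarith, by rw [hj]; congr 1; ring⟩
      · rintro ⟨a, b, c, t, h0, hX⟩
        refine ⟨b, a, c, -t, by linarith, isotropy_injective j ?_⟩
        rw [hX, hj]
        congr 1 <;> ring

/-! ### Maximal flat subspaces, roots and simple roots -/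

/-- The diagonal matrix `i · diag(d)`. -/
noncomputable def dm (d : Fin 3 → ℝ) : Mat := diagonal fun i => I * d i

theorem dm_eq_sm (d : Fin 3 → ℝ) : dm d = sm (d 0) (d 1) (d 2) 0 0 0 := by
  ext i j
  fin_cases i <;> fin_cases j <;> simp [sm, dm]

theorem dm_mem_diagM {d : Fin 3 → ℝ} (h : ∑ i, d i = 0) : dm d ∈ diagM := by
  rw [dm_eq_sm]
  exact sm_mem_diagM (by rwa [Fin.sum_univ_three] at h)

theorem exists_dm_of_mem_diagM {X : Mat} (hX : X ∈ diagM) :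
    ∃ d : Fin 3 → ℝ, ∑ i, d i = 0 ∧ X = dm d := by
  obtain ⟨a, b, c, h, rfl⟩ := mem_diagM_iff.1 hX
  refine ⟨![a, b, c], ?_, ?_⟩
  · simpa [Fin.sum_univ_three] using h
  · rw [dm_eq_sm]
    rfl

theorem lie_dm_apply (d : Fin 3 → ℝ) (Y : Mat) (p q : Fin 3) :
    ⁅dm d, Y⁆ p q = I * (d p - d q) * Y p q := by
  simp only [Ring.lie_def, dm, Matrix.sub_apply, diagonal_mul, mul_diagonal]
  ring

theorem metric_dm (c : ℝ) (d e : Fin 3 → ℝ) : metric c (dm d) (dm e) = c * ∑ i, d i * e i := by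
  simp only [metric, dm, diagonal_conjTranspose, diagonal_mul_diagonal, trace_diagonal, re_sum]
  congr 1
  refine Finset.sum_congr rfl fun i _ => ?_
  simp
  ring

/-- The maximal flat subspaces of `𝔪`. -/
noncomputable abbrev flatM (k : SO3) : Submodule ℝ Mat := diagM.map (isotropy k)

/-- The element of `flatM k` with eigenvalues `i d₀, i d₁, i d₂`. -/
noncomputable def flatMk (k : SO3) (d : Fin 3 → ℝ) (h : ∑ i, d i = 0) : flatM k :=
  ⟨isotropy k (dm d), Submodule.mem_map_of_mem (dm_mem_diagM h)⟩

theorem exists_eq_flatMk {k : SO3} (H : flatM k) :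
    ∃ (d : Fin 3 → ℝ) (h : ∑ i, d i = 0), H = flatMk k d h := by
  obtain ⟨_, X, hX, rfl⟩ := H
  obtain ⟨d, h, rfl⟩ := exists_dm_of_mem_diagM hX
  exact ⟨d, h, rfl⟩

theorem flatM_le_m (k : SO3) : flatM k ≤ m := by
  rw [← map_isotropy_m k]
  exact Submodule.map_mono diagM_le_m

theorem IsFlat.map_isotropy {a : Submodule ℝ Mat} (ha : IsFlat a) (k : SO3) :
    IsFlat (a.map (isotropy k)) := by
  refine ⟨(isLieTripleSystem_of_isFlat ha).map_isotropy k |>.1, ?_⟩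
  rintro _ ⟨u, hu, rfl⟩ _ ⟨v, hv, rfl⟩ _ ⟨w, hw, rfl⟩
  rw [← isotropy_curvature, ha.2 u hu v hv w hw, map_zero]

/-- A diagonal matrix such that the differences of two of its entries are pairwise different. -/
noncomputable def genericDiag : Fin 3 → ℝ := ![4, -1, -3]

theorem sum_genericDiag : ∑ i, genericDiag i = 0 := by
  simp [genericDiag, Fin.sum_univ_three]
  norm_num

theorem genericDiag_sub_eq {p q j l : Fin 3} (hjl : j ≠ l)
    (h : genericDiag p - genericDiag q = genericDiag j - genericDiag l) : p = j ∧ q = l := by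
  -- Over the integers the finitely many cases are decidable; the differences are `±5, ±7, ±2`.
  have key : ∀ p q j l : Fin 3, j ≠ l → (![4, -1, -3] : Fin 3 → ℤ) p - (![4, -1, -3] : _ → ℤ) q =
    (![4, -1, -3] : _ → ℤ) j - (![4, -1, -3] : _ → ℤ) l → p = j ∧ q = l := by decide
  have hg : ∀ i, genericDiag i = ((![4, -1, -3] : Fin 3 → ℤ) i : ℤ) := by
    intro i
    fin_cases i <;> simp [genericDiag]
  refine key p q j l hjl ?_
  rw [hg, hg, hg, hg] at h
  exact_mod_cast h

/-- A matrix commuting with a diagonal matrix with distinct entries is diagonal. -/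
theorem isMaximalFlat_flatM (k : SO3) : IsMaximalFlat (flatM k) := by
  refine ⟨isFlat_diagM.map_isotropy k, fun b hb hle X hX => ?_⟩
  rw [mem_map_isotropy]
  refine ⟨isotropy_mem_m _ (hb.1 hX), fun i j hij => ?_⟩
  have h := lie_eq_zero_of_isFlat hb (hle (flatMk k genericDiag sum_genericDiag).2) hX
  have h' : ⁅dm genericDiag, isotropy k⁻¹ X⁆ = 0 := by
    apply isotropy_injective k
    rw [isotropy_lie, isotropy_apply_inv, map_zero]
    exact h
  have e := congrFun (congrFun h' i) j
  rw [lie_dm_apply] at e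
  refine (mul_eq_zero.1 e).resolve_left (mul_ne_zero I_ne_zero fun h0 => ?_)
  have h0' : genericDiag i - genericDiag j = 0 := by exact_mod_cast h0
  have := genericDiag_sub_eq hij (p := j) (q := i) (by linarith)
  exact hij this.2

/-- The element `H` is meant to be the regular vector that defines positivity: sorting its
eigenvalues moves its Weyl chamber to the standard one. -/
theorem IsMaximalFlat.exists_eq_flatM {a : Submodule ℝ Mat} (ha : IsMaximalFlat a) (H : a) :
    ∃ k : SO3, a = flatM k ∧
      ∃ d : Fin 3 → ℝ, Antitone d ∧ isotropy k⁻¹ H = dm d := by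
  obtain ⟨k, hk, d, hd, hH⟩ := ha.1.exists_diagonal H.2
  exact ⟨k, ha.eq_of_le (isFlat_diagM.map_isotropy k) hk, d, hd, hH.trans (dm_eq_sm d).symm⟩

/-- The linear form `H ↦ H_j - H_l` on `flatM k`, where `H_j` are the eigenvalues of `H`. -/
noncomputable def rootForm (k : SO3) (j l : Fin 3) : flatM k →ₗ[ℝ] ℂ where
  toFun H := isotropy k⁻¹ (H : Mat) j j - isotropy k⁻¹ (H : Mat) l l
  map_add' H H' := by simp only [Submodule.coe_add, map_add, Matrix.add_apply]; ring
  map_smul' r H := by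
    simp only [Submodule.coe_smul, map_smul, Matrix.smul_apply, RingHom.id_apply, smul_sub]

theorem rootForm_eq {k : SO3} {H : flatM k} {d : Fin 3 → ℝ} (h : isotropy k⁻¹ (H : Mat) = dm d)
    (j l : Fin 3) : rootForm k j l H = I * (d j - d l) := by
  simp only [rootForm, LinearMap.coe_mk, AddHom.coe_mk, h, dm, diagonal_apply_eq]
  ring

theorem isotropy_inv_flatMk (k : SO3) {d : Fin 3 → ℝ} (h : ∑ i, d i = 0) :
    isotropy k⁻¹ (flatMk k d h : Mat) = dm d :=
  isotropy_inv_apply k _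

theorem rootForm_flatMk (k : SO3) {d : Fin 3 → ℝ} (h : ∑ i, d i = 0) (j l : Fin 3) :
    rootForm k j l (flatMk k d h) = I * (d j - d l) :=
  rootForm_eq (isotropy_inv_flatMk k h) j l

theorem neg_rootForm (k : SO3) (j l : Fin 3) : -rootForm k j l = rootForm k l j := by
  ext H
  simp [rootForm]

theorem rootForm_add (k : SO3) (j l q : Fin 3) :
    rootForm k j l + rootForm k l q = rootForm k j q := by
  ext H
  simp [rootForm]

theorem rootForm_self (k : SO3) (j : Fin 3) : rootForm k j j = 0 := by
  ext H
  simp [rootForm]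

theorem rootForm_inj {k : SO3} {p q j l : Fin 3} (hjl : j ≠ l)
    (h : rootForm k p q = rootForm k j l) : p = j ∧ q = l := by
  have e := LinearMap.congr_fun h (flatMk k genericDiag sum_genericDiag)
  rw [rootForm_flatMk, rootForm_flatMk] at e
  have e' := mul_left_cancel₀ I_ne_zero e
  exact genericDiag_sub_eq hjl (by exact_mod_cast e')

theorem rootForm_ne_zero {k : SO3} {j l : Fin 3} (hjl : j ≠ l) : rootForm k j l ≠ 0 := by
  intro h
  rw [← rootForm_self k l] at h
  exact hjl (rootForm_inj hjl h.symm).1.symm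

/-- At each point `α = ±β`, and a vector space is not the union of two proper subspaces: if `v`
violates one sign and `w` the other, then `v + w` violates both. -/
theorem eq_or_eq_neg_of_sq_eq {W : Type*} [AddCommGroup W] [Module ℝ W] {α β : W →ₗ[ℝ] ℂ}
    (h : ∀ w, α w ^ 2 = β w ^ 2) : α = β ∨ α = -β := by
  by_contra hcon
  push Not at hcon
  obtain ⟨h1, h2⟩ := hcon
  obtain ⟨v, hv⟩ := DFunLike.ne_iff.1 h1
  obtain ⟨w, hw⟩ := DFunLike.ne_iff.1 h2
  rw [LinearMap.neg_apply] at hw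
  have hv' := (sq_eq_sq_iff_eq_or_eq_neg.1 (h v)).resolve_left hv
  have hw' := (sq_eq_sq_iff_eq_or_eq_neg.1 (h w)).resolve_right hw
  have hs := sq_eq_sq_iff_eq_or_eq_neg.1 (h (v + w))
  rw [map_add, map_add, hv', hw'] at hs
  rcases hs with hs | hs
  · exact hv (by rw [hv']; linear_combination hs)
  · exact hw (by rw [hw']; linear_combination hs)

theorem mem_roots_iff {k : SO3} {α : flatM k →ₗ[ℝ] ℂ} :
    α ∈ roots (flatM k) ↔ ∃ j l, j ≠ l ∧ α = rootForm k j l := by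
  constructor
  · rintro ⟨hα, X, -, hX0, hX⟩
    have hY0 : isotropy k⁻¹ X ≠ 0 := fun h => hX0 (isotropy_injective k⁻¹ (by rw [h, map_zero]))
    -- One non-zero entry of the eigenvector suffices, since `ad(H)²` multiplies the entry at `(j,
    -- l)` by the square of `rootForm k j l H`.
    obtain ⟨j, l, hjl⟩ : ∃ j l, isotropy k⁻¹ X j l ≠ 0 := by
      by_contra hcon
      push Not at hcon
      exact hY0 (Matrix.ext hcon)
    have hsq : ∀ H, α H ^ 2 = rootForm k j l H ^ 2 := by
      intro H
      obtain ⟨d, hd, rfl⟩ := exists_eq_flatMk H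
      have h := congrArg (isotropy k⁻¹) (hX (flatMk k d hd))
      rw [isotropy_lie, isotropy_lie, isotropy_inv_flatMk, isotropy_smul] at h
      have e := congrFun (congrFun h j) l
      rw [lie_dm_apply, lie_dm_apply, Matrix.smul_apply, smul_eq_mul, ← mul_assoc] at e
      rw [rootForm_flatMk, ← mul_right_cancel₀ hjl e]
      ring
    have hne : j ≠ l := by
      rintro rfl
      refine hα (LinearMap.ext fun H => ?_)
      have := hsq H
      rw [rootForm_self] at this
      simpa using this
    rcases eq_or_eq_neg_of_sq_eq hsq with h | h
    · exact ⟨j, l, hne, h⟩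
    · exact ⟨l, j, hne.symm, h.trans (neg_rootForm k j l)⟩
  · rintro ⟨j, l, hjl, rfl⟩
    -- The difference of the two matrix units is real skew-symmetric, hence in `𝔰𝔲(3)`; both have
    -- the same eigenvalue under `ad(H)²`, as squaring forgets the sign of the root.
    refine ⟨rootForm_ne_zero hjl, isotropy k (single j l 1 - single l j 1),
      isotropy_mem_su3 k ⟨?_, ?_⟩, ?_, fun H => ?_⟩
    · simp
    · simp [trace_single_eq_of_ne _ _ _ hjl, trace_single_eq_of_ne _ _ _ hjl.symm]
    · intro h
      have h' := isotropy_injective k (h.trans (map_zero (isotropy k)).symm)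
      have e := congrFun (congrFun h' j) l
      simp [hjl.symm] at e
    · obtain ⟨d, hd, rfl⟩ := exists_eq_flatMk H
      apply isotropy_injective k⁻¹
      rw [isotropy_lie, isotropy_lie, isotropy_inv_flatMk, isotropy_smul, isotropy_inv_apply,
        rootForm_flatMk]
      ext p q
      rw [lie_dm_apply, lie_dm_apply, Matrix.smul_apply, smul_eq_mul, Matrix.sub_apply,
        single_apply, single_apply]
      split_ifs with h1 h2 h2
      · ring
      · obtain ⟨rfl, rfl⟩ := h1
        ring
      · obtain ⟨rfl, rfl⟩ := h2
        ring
      · ring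

theorem rootForm_mem_roots {k : SO3} {j l : Fin 3} (hjl : j ≠ l) :
    rootForm k j l ∈ roots (flatM k) :=
  mem_roots_iff.2 ⟨j, l, hjl, rfl⟩

/-- On diagonal matrices the metric is `c` times the standard scalar product of the eigenvalues
(`metric_dm`), so `d j - d l` is represented by the difference of two unit vectors divided by `c`.
-/
theorem rootVector_rootForm {c : ℝ} (hc : 0 < c) {k : SO3} {j l : Fin 3} (hjl : j ≠ l) :
    rootVector c (flatM k) (rootForm k j l) =
      isotropy k (((1 / c : ℝ) * I) • (single j j 1 - single l l 1)) := by
  have hs : ((1 / c : ℝ) * I) • (single j j (1 : ℂ) - single l l 1) =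
      dm fun i => 1 / c * ((if i = j then 1 else 0) - (if i = l then 1 else 0)) := by
    ext p q
    simp only [dm, Matrix.smul_apply, Matrix.sub_apply, single_apply, diagonal_apply, smul_eq_mul]
    by_cases hpq : p = q
    · subst hpq
      simp only [and_self, eq_comm (a := j), eq_comm (a := l), if_true]
      split_ifs <;> push_cast <;> ring
    · have h1 : ∀ i, ¬ (i = p ∧ i = q) := fun i h => hpq (h.1.symm.trans h.2)
      simp [hpq, h1]
  obtain ⟨h1, h2⟩ := rootVector_spec hc (flatM_le_m k) (rootForm_mem_roots (k := k) hjl)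
  refine rootVector_unique hc h1 (Submodule.mem_map_of_mem ?_) fun A => ?_
  · rw [hs]
    exact dm_mem_diagM (by simp [← Finset.mul_sum])
  · have h3 := h2 A
    obtain ⟨d, hd, rfl⟩ := exists_eq_flatMk A
    rw [rootForm_flatMk] at h3
    have h4 : metric c (rootVector c (flatM k) (rootForm k j l)) (flatMk k d hd) = d j - d l := by
      apply ofReal_injective
      rw [h3]
      push_cast
      field_simp [I_ne_zero]
    rw [h4, hs, flatMk, isotropy_metric, metric_dm]
    simp only [mul_assoc, ← Finset.mul_sum, sub_mul, ite_mul, one_mul, zero_mul,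
      Finset.sum_sub_distrib, Finset.sum_ite_eq', Finset.mem_univ, if_true]
    field_simp

theorem mem_positiveRoots_iff {k : SO3} {H : flatM k} {d : Fin 3 → ℝ}
    (h : isotropy k⁻¹ (H : Mat) = dm d) (h01 : d 1 < d 0) (h12 : d 2 < d 1)
    {α : flatM k →ₗ[ℝ] ℂ} : α ∈ positiveRoots (flatM k) H ↔
      α = rootForm k 0 1 ∨ α = rootForm k 1 2 ∨ α = rootForm k 0 2 := by
  have hpos : ∀ j l, (∃ t : ℝ, 0 < t ∧ rootForm k j l H = I * t) ↔ d l < d j := by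
    intro j l
    rw [rootForm_eq h]
    constructor
    · rintro ⟨t, ht, e⟩
      have e' := mul_left_cancel₀ I_ne_zero e
      have : d j - d l = t := by exact_mod_cast e'
      linarith
    · intro hlt
      exact ⟨d j - d l, sub_pos.2 hlt, by push_cast; rfl⟩
  constructor
  · rintro ⟨hα, hp⟩
    obtain ⟨j, l, hjl, rfl⟩ := mem_roots_iff.1 hα
    rw [hpos] at hp
    fin_cases j <;> fin_cases l <;> simp at hjl hp ⊢ <;> exfalso <;> linarith
  · rintro (rfl | rfl | rfl)
    · exact ⟨rootForm_mem_roots (by decide), (hpos _ _).2 h01⟩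
    · exact ⟨rootForm_mem_roots (by decide), (hpos _ _).2 h12⟩
    · exact ⟨rootForm_mem_roots (by decide), (hpos _ _).2 (h12.trans h01)⟩

theorem simpleRoots_flatM {k : SO3} {H : flatM k} {d : Fin 3 → ℝ}
    (h : isotropy k⁻¹ (H : Mat) = dm d) (h01 : d 1 < d 0) (h12 : d 2 < d 1) :
    simpleRoots (flatM k) H = {rootForm k 0 1, rootForm k 1 2} := by
  -- The height of a root is read off at `diag(1, 0, -1)`: positive roots have height at least 1, so
  -- a root of height 1 cannot be a sum of two of them.
  have h0 : ∑ i, (![1, 0, -1] : Fin 3 → ℝ) i = 0 := by simp [Fin.sum_univ_three]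
  have hone : ∀ α ∈ positiveRoots (flatM k) H, 1 ≤ (α (flatMk k ![1, 0, -1] h0)).im := by
    intro α hα
    rcases (mem_positiveRoots_iff h h01 h12).1 hα with rfl | rfl | rfl <;>
      rw [rootForm_flatMk] <;> simp
  have hsum : ∀ β ∈ positiveRoots (flatM k) H, ∀ γ ∈ positiveRoots (flatM k) H,
      2 ≤ ((β + γ) (flatMk k ![1, 0, -1] h0)).im := by
    intro β hβ γ hγ
    rw [LinearMap.add_apply, add_im]
    linarith [hone β hβ, hone γ hγ]
  ext α
  simp only [simpleRoots, Set.mem_ofPred_eq, Set.mem_insert_iff, Set.mem_singleton_iff]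
  constructor
  · rintro ⟨hα, hns⟩
    rcases (mem_positiveRoots_iff h h01 h12).1 hα with rfl | rfl | rfl
    · exact Or.inl rfl
    · exact Or.inr rfl
    · exact absurd ⟨rootForm k 0 1, (mem_positiveRoots_iff h h01 h12).2 (Or.inl rfl),
        rootForm k 1 2, (mem_positiveRoots_iff h h01 h12).2 (Or.inr (Or.inl rfl)),
        (rootForm_add k 0 1 2).symm⟩ hns
  · rintro (rfl | rfl)
    · refine ⟨(mem_positiveRoots_iff h h01 h12).2 (Or.inl rfl), ?_⟩
      rintro ⟨β, hβ, γ, hγ, e⟩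
      have := hsum β hβ γ hγ
      rw [← e, rootForm_flatMk] at this
      norm_num at this
    · refine ⟨(mem_positiveRoots_iff h h01 h12).2 (Or.inr (Or.inl rfl)), ?_⟩
      rintro ⟨β, hβ, γ, hγ, e⟩
      have := hsum β hβ γ hγ
      rw [← e, rootForm_flatMk] at this
      have h2 : (![1, 0, -1] : Fin 3 → ℝ) 2 = -1 := rfl
      norm_num [h2] at this

theorem isSimpleSystem_flatM (k : SO3) :
    IsSimpleSystem (flatM k) (rootForm k 0 1) (rootForm k 1 2) := by
  refine ⟨fun h => ?_, flatMk k genericDiag sum_genericDiag, ?_,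
    simpleRoots_flatM (isotropy_inv_flatMk k _) ?_ ?_⟩
  · exact absurd (rootForm_inj (by decide) h).1 (by decide)
  · intro α hα h
    obtain ⟨j, l, hjl, rfl⟩ := mem_roots_iff.1 hα
    rw [rootForm_flatMk, mul_eq_zero, or_iff_right I_ne_zero] at h
    have h' : genericDiag j - genericDiag l = 0 := by exact_mod_cast h
    exact hjl (genericDiag_sub_eq hjl (p := l) (q := j) (by linarith)).2
  · simp [genericDiag]; norm_num
  · simp [genericDiag]

/-- Every system of simple roots is, up to order, a standard one. -/
theorem IsSimpleSystem.exists_eq_rootForm {a : Submodule ℝ Mat} (ha : IsMaximalFlat a)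
    {α₁ α₂ : a →ₗ[ℝ] ℂ} (h : IsSimpleSystem a α₁ α₂) :
    ∃ (k : SO3) (e : a = flatM k),
      (e ▸ α₁ = rootForm k 0 1 ∧ e ▸ α₂ = rootForm k 1 2) ∨
      (e ▸ α₂ = rootForm k 0 1 ∧ e ▸ α₁ = rootForm k 1 2) := by
  obtain ⟨hne, H, hreg, hs⟩ := h
  obtain ⟨k, rfl, d, hd, hH⟩ := ha.exists_eq_flatM H
  refine ⟨k, rfl, ?_⟩
  -- Regularity of `H` makes the decreasing eigenvalues strictly decreasing.
  have hlt : ∀ j l, j < l → d l < d j := by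
    intro j l hjl
    refine lt_of_le_of_ne (hd hjl.le) fun h => ?_
    refine hreg _ (rootForm_mem_roots hjl.ne) ?_
    rw [rootForm_eq hH, h, sub_self, mul_zero]
  rw [simpleRoots_flatM hH (hlt 0 1 (by decide)) (hlt 1 2 (by decide))] at hs
  rcases Set.pair_eq_pair_iff.1 hs with ⟨h1, h2⟩ | ⟨h1, h2⟩
  · exact Or.inl ⟨h1.symm, h2.symm⟩
  · exact Or.inr ⟨h1.symm, h2.symm⟩

/-! ### Adapted Chevalley bases -/

theorem lie_single_single_same {j l : Fin 3} (a b : ℂ) :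
    ⁅(single j l a : Mat), single l j b⁆ = (a * b) • (single j j 1 - single l l 1) := by
  rw [Ring.lie_def, single_mul_single_same, single_mul_single_same, smul_sub, smul_single,
    smul_single, smul_eq_mul, mul_one, mul_comm b a]

/-- The vectors of a Chevalley basis are multiples of matrix units. -/
theorem IsChevalleyBasis.exists_single {c : ℝ} {k : SO3} {X : (flatM k →ₗ[ℝ] ℂ) → Mat}
    (hX : IsChevalleyBasis c (flatM k) X) {j l : Fin 3} (hjl : j ≠ l) :
    ∃ z : ℂ, X (rootForm k j l) = isotropy k (single j l z) := by
  refine ⟨isotropy k⁻¹ (X (rootForm k j l)) j l, isotropy_injective k⁻¹ ?_⟩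
  rw [isotropy_inv_apply]
  have h := congrArg (isotropy k⁻¹) (hX.mem_rootSpace _ (rootForm_mem_roots hjl)
    (flatMk k genericDiag sum_genericDiag))
  rw [isotropy_lie, isotropy_inv_flatMk, isotropy_smul, rootForm_flatMk] at h
  ext p q
  rw [single_apply]
  split_ifs with hpq
  · rw [hpq.1, hpq.2]
  · by_contra hne
    have e := congrFun (congrFun h p) q
    rw [lie_dm_apply, Matrix.smul_apply, smul_eq_mul] at e
    have e' := mul_left_cancel₀ I_ne_zero (mul_right_cancel₀ hne e)
    have := genericDiag_sub_eq hjl (by exact_mod_cast e')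
    exact hpq ⟨this.1.symm, this.2.symm⟩

theorem isotropy_single_inj {k : SO3} {j l : Fin 3} {a b : ℂ}
    (h : isotropy k (single j l a) = isotropy k (single j l b)) : a = b := by
  have := congrFun (congrFun (isotropy_injective k h) j) l
  simpa using this

theorem sigma_isotropy_single (k : SO3) (j l : Fin 3) (z : ℂ) :
    sigma (isotropy k (single j l z)) = isotropy k (single l j (-z)) := by
  rw [← isotropy_sigma, sigma, transpose_single, ← single_neg]

theorem neg_conj_isotropy_single (k : SO3) (j l : Fin 3) (z : ℂ) :
    -conj (isotropy k (single j l z)) = isotropy k (single l j (starRingEnd ℂ z)) := by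
  rw [conj, neg_neg, ← isotropy_conjTranspose, conjTranspose_single]
  rfl

theorem sm_eq_single (x y z : ℝ) : sm 0 0 0 x y z =
    I • (single 0 1 (x : ℂ) + single 1 0 (x : ℂ) + single 0 2 (y : ℂ) + single 2 0 (y : ℂ)
      + single 1 2 (z : ℂ) + single 2 1 (z : ℂ)) := by
  ext i j
  fin_cases i <;> fin_cases j <;> simp [sm]

/-- The vectors `M_α(1)` for an adapted Chevalley basis. -/
theorem IsAdaptedChevalleyBasis.exists_M_eq {c : ℝ} (hc : 0 < c) {k : SO3}
    {X : (flatM k →ₗ[ℝ] ℂ) → Mat}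
    (hX : IsAdaptedChevalleyBasis c (flatM k) (rootForm k 0 1) (rootForm k 1 2) X) :
    ∃ s y ε : ℝ, s ≠ 0 ∧ y ≠ 0 ∧ (ε = 1 ∨ ε = -1) ∧
      M X (rootForm k 0 1 + rootForm k 1 2) 1 = s • isotropy k (sm 0 0 0 0 1 0) ∧
      M X (rootForm k 0 1) 1 + M X (rootForm k 1 2) 1 = y • isotropy k (sm 0 0 0 1 0 ε) ∧
      ∀ w : ℂ, X (rootForm k 0 1) = isotropy k (single 0 1 w) →
        X (rootForm k 1 2) = isotropy k (single 1 2 w) → ε = 1 := by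
  have hex : ∀ j l : Fin 3, ∃ z : ℂ, j ≠ l → X (rootForm k j l) = isotropy k (single j l z) := by
    intro j l
    by_cases h : j = l
    · exact ⟨0, fun h' => absurd h h'⟩
    · obtain ⟨z, hz⟩ := hX.exists_single h
      exact ⟨z, fun _ => hz⟩
  choose z hz using hex
  obtain ⟨N, hN⟩ := hX.exists_constants
  have hstar : ∀ j l, j ≠ l → z l j = starRingEnd ℂ (z j l) := by
    intro j l h
    have e := hX.neg_eq _ (rootForm_mem_roots (k := k) h)
    rw [neg_rootForm, hz j l h, hz l j h.symm, neg_conj_isotropy_single] at e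
    exact isotropy_single_inj e
  -- This is the relation `[X_α, X_{-α}] = -i H_α`: the factor `-i` cancels the `i` in `H_α`.
  have hnorm : ∀ j l, j ≠ l → z j l * z l j = (1 / c : ℝ) := by
    intro j l h
    have e := (hN _ (rootForm_mem_roots (k := k) h) _ (rootForm_mem_roots (k := k) h.symm)).2.1
      (by rw [rootForm_add, rootForm_self])
    rw [hz j l h, hz l j h.symm, rootVector_rootForm hc h, ← isotropy_lie, ← isotropy_smul,
      lie_single_single_same, smul_smul] at e
    have e' := congrFun (congrFun (isotropy_injective k e) j) j
    simp only [Matrix.smul_apply, Matrix.sub_apply, single_apply_same, single_apply_of_row_ne h.symm,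
      sub_zero, smul_eq_mul, mul_one] at e'
    rw [e']
    linear_combination (-((1 / c : ℝ) : ℂ)) * I_mul_I
  have hs01 : -z 0 1 = z 1 0 := by
    have e := hX.sigma_fst
    rw [neg_rootForm, hz 0 1 (by decide), hz 1 0 (by decide), sigma_isotropy_single] at e
    exact isotropy_single_inj e
  have hs12 : -z 1 2 = z 2 1 := by
    have e := hX.sigma_snd
    rw [neg_rootForm, hz 1 2 (by decide), hz 2 1 (by decide), sigma_isotropy_single] at e
    exact isotropy_single_inj e
  have hc' : (1 / c : ℝ) ≠ 0 := by positivity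
  -- Compatibility with `σ` forces the coefficients of the simple root vectors to be purely
  -- imaginary, of modulus squared `1 / c`; this leaves only a sign for each.
  have him : ∀ j l, j ≠ l → -z j l = z l j → z j l = I * ((z j l).im : ℝ) ∧
      (z j l).im * (z j l).im = 1 / c := by
    intro j l h hs
    have h1 := hstar j l h
    rw [← hs] at h1
    have hre : (z j l).re = 0 := by
      have := congrArg re h1
      simp only [neg_re, conj_re] at this
      linarith
    refine ⟨by apply Complex.ext <;> simp [hre], ?_⟩
    have h2 := congrArg re (hnorm j l h)
    rw [← hs, mul_re, neg_re, neg_im, hre, ofReal_re] at h2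
    linarith
  obtain ⟨e01, n01⟩ := him 0 1 (by decide) hs01
  obtain ⟨e12, n12⟩ := him 1 2 (by decide) hs12
  set p := (z 0 1).im
  set q := (z 1 2).im
  have hp : p ≠ 0 := by
    rintro h
    rw [h, zero_mul] at n01
    exact hc' n01.symm
  have hq : q ≠ 0 := by
    rintro h
    rw [h, zero_mul] at n12
    exact hc' n12.symm
  have hz02 : z 0 2 ≠ 0 := by
    intro h
    have := hnorm 0 2 (by decide)
    rw [h, zero_mul] at this
    exact hc' (by exact_mod_cast this.symm)
  -- A product of two imaginary coefficients is real, and so is the structure constant, which cannot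
  -- vanish; hence the coefficient for `α₃` is real. Therefore `σ` has the opposite sign there, and
  -- `M` takes its second branch.
  have hr : ∃ r : ℝ, z 0 2 = r := by
    have e := (hN _ (rootForm_mem_roots (k := k) (show (0 : Fin 3) ≠ 1 by decide)) _
      (rootForm_mem_roots (k := k) (show (1 : Fin 3) ≠ 2 by decide))).1
      (by rw [rootForm_add]; exact rootForm_mem_roots (by decide))
    rw [rootForm_add, hz 0 1 (by decide), hz 1 2 (by decide), hz 0 2 (by decide), ← isotropy_lie,
      ← map_smul] at e
    have e0 := isotropy_injective k e
    rw [Ring.lie_def, single_mul_single_same,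
      single_mul_single_of_ne (j := 2) (k := 0) (h := by decide), sub_zero, smul_single] at e0
    have e' := congrFun (congrFun e0 0) 2
    rw [single_apply_same, single_apply_same, real_smul, e01, e12] at e'
    set n := N (rootForm k 0 1) (rootForm k 1 2)
    have hn : n ≠ 0 := by
      intro hn
      rw [hn, ofReal_zero, zero_mul] at e'
      simp [hp, hq] at e'
    refine ⟨-(p * q) / n, ?_⟩
    have hn' : (n : ℂ) ≠ 0 := ofReal_ne_zero.2 hn
    push_cast
    rw [eq_div_iff hn']
    linear_combination -e' + (p * q : ℂ) * I_mul_I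
  obtain ⟨r, hr⟩ := hr
  have hr0 : r ≠ 0 := fun h => hz02 (by rw [hr, h, ofReal_zero])
  have e20 : z 2 0 = r := by
    rw [hstar 0 2 (by decide), hr, conj_ofReal]
  have hsq : (1 / √2 : ℝ) ≠ 0 := by positivity
  have hM : ∀ j l, j ≠ l → -z j l = z l j → M X (rootForm k j l) 1 =
      (((1 / √2 : ℝ) : ℂ) * z j l) • isotropy k (single j l 1 + single l j 1) := by
    intro j l h hs
    have hsig : sigma (X (rootForm k j l)) = X (-rootForm k j l) := by
      rw [neg_rootForm, hz j l h, hz l j h.symm, sigma_isotropy_single, hs]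
    rw [M, if_pos hsig, V, neg_rootForm, hz j l h, hz l j h.symm, ← hs, ofReal_one, map_one,
      one_smul, one_smul, ← map_sub, mul_smul, ← isotropy_smul (z := z j l), smul_add, smul_single,
      smul_single, smul_eq_mul, mul_one, ← single_neg, sub_neg_eq_add]
  -- The ratio `q / p` is the relative sign of the two simple root vectors, which the axioms leave
  -- open.
  refine ⟨1 / √2 * r, 1 / √2 * p, q / p, mul_ne_zero hsq hr0, mul_ne_zero hsq hp, ?_, ?_, ?_,
    fun w h1 h2 => ?_⟩
  · rw [div_eq_iff hp, div_eq_iff hp, one_mul, neg_one_mul]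
    exact mul_self_eq_mul_self_iff.1 (n12.trans n01.symm)
  · have hsig : ¬ sigma (X (rootForm k 0 2)) = X (-rootForm k 0 2) := by
      rw [neg_rootForm, hz 0 2 (by decide), hz 2 0 (by decide), sigma_isotropy_single, hr, e20]
      intro h
      have := isotropy_single_inj h
      have h' : -r = r := by exact_mod_cast this
      exact hr0 (by linarith)
    rw [rootForm_add, M, if_neg hsig, V, neg_rootForm, hz 0 2 (by decide), hz 2 0 (by decide), hr,
      e20, ← (isotropy k).map_smul (1 / √2 * r), ← isotropy_smul, ← isotropy_smul, ← map_sub, ← isotropy_smul, sm_eq_single]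
    congr 1
    ext i j
    fin_cases i <;> fin_cases j <;> simp <;> ring
  · have hpc : (p : ℂ) ≠ 0 := ofReal_ne_zero.2 hp
    rw [hM 0 1 (by decide) hs01, hM 1 2 (by decide) hs12, e01, e12, ← (isotropy k).map_smul (1 / √2 * p), ← isotropy_smul,
      ← isotropy_smul, ← map_add, sm_eq_single]
    congr 1
    ext i j
    fin_cases i <;> fin_cases j <;> simp <;> field_simp
  · rw [hz 0 1 (by decide)] at h1
    rw [hz 1 2 (by decide)] at h2
    have hpq : q = p := congrArg im ((isotropy_single_inj h2).trans (isotropy_single_inj h1).symm)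
    rw [hpq, div_self hp]

/-- Adapted Chevalley bases exist. -/
theorem exists_isAdaptedChevalleyBasis {c : ℝ} (hc : 0 < c) (k : SO3) :
    ∃ X, IsAdaptedChevalleyBasis c (flatM k) (rootForm k 0 1) (rootForm k 1 2) X ∧
      ∃ w : ℂ, X (rootForm k 0 1) = isotropy k (single 0 1 w) ∧
        X (rootForm k 1 2) = isotropy k (single 1 2 w) := by
  obtain ⟨y, hy⟩ : ∃ y : ℝ, y * y = 1 / c :=
    ⟨√(1 / c), Real.mul_self_sqrt (by positivity)⟩
  -- The basis consists of `y` times the matrix units conjugated by a diagonal unitary matrix. The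
  -- phases `1, i, -1` give both simple root vectors the same imaginary coefficient `y i`, so the
  -- relative sign is `1`.
  obtain ⟨w, hw, hw1, hw2⟩ : ∃ w : Fin 3 → ℂ, (∀ i, w i * starRingEnd ℂ (w i) = 1) ∧
      starRingEnd ℂ (w 0) * w 1 = I ∧ starRingEnd ℂ (w 1) * w 2 = I := by
    refine ⟨![1, I, -1], fun i => ?_, ?_, ?_⟩
    · fin_cases i <;> simp
    · simp
    · simp
  have hinj : Function.Injective fun p : {p : Fin 3 × Fin 3 // p.1 ≠ p.2} =>
      rootForm k p.1.1 p.1.2 := by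
    intro p q h
    have := rootForm_inj q.2 h
    exact Subtype.ext (Prod.ext this.1 this.2)
  set X : (flatM k →ₗ[ℝ] ℂ) → Mat := Function.extend
    (fun p : {p : Fin 3 × Fin 3 // p.1 ≠ p.2} => rootForm k p.1.1 p.1.2)
    (fun p => isotropy k (single p.1.1 p.1.2 (y * (starRingEnd ℂ (w p.1.1) * w p.1.2)))) 0
  have hX : ∀ {j l : Fin 3}, j ≠ l → X (rootForm k j l) =
      isotropy k (single j l (y * (starRingEnd ℂ (w j) * w l))) :=
    fun {j l} h => hinj.extend_apply _ _ ⟨(j, l), h⟩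
  -- The matrix units have structure constants `δ_{lp} - δ_{jq}`; the phases cancel and one factor
  -- `y` remains. Transposing both index pairs exchanges the two deltas, whence the sign rule. The
  -- default `0` off the roots plays no role.
  set N : (flatM k →ₗ[ℝ] ℂ) × (flatM k →ₗ[ℝ] ℂ) → ℝ := Function.extend
    (Prod.map (fun p : {p : Fin 3 × Fin 3 // p.1 ≠ p.2} => rootForm k p.1.1 p.1.2)
      (fun p : {p : Fin 3 × Fin 3 // p.1 ≠ p.2} => rootForm k p.1.1 p.1.2))
    (fun p => y * ((if p.1.1.2 = p.2.1.1 then 1 else 0) - if p.1.1.1 = p.2.1.2 then 1 else 0)) 0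
  have hN : ∀ {j l p q : Fin 3}, j ≠ l → p ≠ q → N (rootForm k j l, rootForm k p q) =
      y * ((if l = p then 1 else 0) - if j = q then 1 else 0) :=
    fun {j l p q} h h' => (hinj.prodMap hinj).extend_apply _ _ (⟨(j, l), h⟩, ⟨(p, q), h'⟩)
  refine ⟨X, ⟨⟨fun α hα => ?_, fun α hα H => ?_, fun α β => N (α, β), fun α hα β hβ => ?_⟩,
    fun α hα => ?_, ?_, ?_⟩,
    y * I, by rw [hX (by decide), hw1], by rw [hX (by decide), hw2]⟩
  · obtain ⟨j, l, h, rfl⟩ := mem_roots_iff.1 hα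
    rw [hX h, LieAlgebra.SpecialLinear.sl, LieSubalgebra.mem_mk_iff']
    rw [LinearMap.mem_ker, traceLinearMap_apply, isotropy_trace, trace_single_eq_of_ne _ _ _ h]
  · obtain ⟨j, l, h, rfl⟩ := mem_roots_iff.1 hα
    obtain ⟨d, hd, rfl⟩ := exists_eq_flatMk H
    apply isotropy_injective k⁻¹
    rw [hX h, isotropy_lie, isotropy_inv_flatMk, isotropy_smul, isotropy_inv_apply, rootForm_flatMk]
    ext p q
    rw [lie_dm_apply, Matrix.smul_apply, smul_eq_mul, single_apply]
    split_ifs with hpq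
    · rw [hpq.1, hpq.2]
    · ring
  · obtain ⟨j, l, h, rfl⟩ := mem_roots_iff.1 hα
    obtain ⟨p, q, h', rfl⟩ := mem_roots_iff.1 hβ
    have hneg : N (-rootForm k j l, -rootForm k p q) = -N (rootForm k j l, rootForm k p q) := by
      rw [neg_rootForm, neg_rootForm, hN h.symm h'.symm, hN h h']
      ring
    beta_reduce
    rw [hX h, hX h', ← isotropy_lie, hN h h']
    rw [hN h h'] at hneg
    by_cases hlp : l = p
    · subst hlp
      by_cases hjq : j = q
      · subst hjq
        rw [rootForm_add, rootForm_self]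
        refine ⟨fun h0 => absurd rfl h0.1, fun _ => ?_, fun _ h0 => absurd rfl h0, hneg⟩
        rw [rootVector_rootForm hc h, ← isotropy_smul, lie_single_single_same, smul_smul, ← hy]
        congr 2
        push_cast
        linear_combination ((y * y : ℂ) * (w l * starRingEnd ℂ (w l))) * hw j +
          (y * y : ℂ) * hw l + (y * y : ℂ) * I_mul_I
      · rw [rootForm_add]
        refine ⟨fun _ => ?_, fun h0 => absurd h0 (rootForm_ne_zero hjq),
          fun h0 => absurd (rootForm_mem_roots hjq) h0, hneg⟩
        rw [hX hjq, ← map_smul, Ring.lie_def, single_mul_single_same,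
          single_mul_single_of_ne _ _ _ _ (Ne.symm hjq), sub_zero, if_pos rfl, if_neg hjq]
        congr 1
        rw [smul_single]
        congr 1
        rw [real_smul]
        push_cast
        linear_combination ((y * y : ℂ) * (starRingEnd ℂ (w j) * w q)) * hw l
    · by_cases hjq : j = q
      · subst hjq
        rw [add_comm, rootForm_add]
        refine ⟨fun _ => ?_, fun h0 => absurd h0 (rootForm_ne_zero (Ne.symm hlp)),
          fun h0 => absurd (rootForm_mem_roots (Ne.symm hlp)) h0, hneg⟩
        rw [hX (Ne.symm hlp), ← map_smul, Ring.lie_def, single_mul_single_same,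
          single_mul_single_of_ne _ _ _ _ hlp, zero_sub, if_pos rfl, if_neg hlp]
        congr 1
        rw [smul_single, single_neg]
        congr 1
        rw [real_smul]
        push_cast
        linear_combination (-(y * y : ℂ) * (starRingEnd ℂ (w p) * w l)) * hw j
      · have h0 : ⁅(single j l (y * (starRingEnd ℂ (w j) * w l)) : Mat),
            single p q (y * (starRingEnd ℂ (w p) * w q))⁆ = 0 := by
          rw [Ring.lie_def, single_mul_single_of_ne _ _ _ _ hlp,
            single_mul_single_of_ne _ _ _ _ (Ne.symm hjq), sub_zero]
        rw [h0, map_zero, if_neg hlp, if_neg hjq, sub_zero, mul_zero, zero_smul]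
        refine ⟨fun _ => rfl, fun h1 => ?_, fun _ _ => rfl, by simpa [hlp, hjq] using hneg⟩
        rw [add_eq_zero_iff_eq_neg, neg_rootForm] at h1
        exact absurd (rootForm_inj h'.symm h1).1 hjq
  · obtain ⟨j, l, h, rfl⟩ := mem_roots_iff.1 hα
    rw [neg_rootForm, hX h, hX h.symm, neg_conj_isotropy_single]
    simp only [map_mul, conj_ofReal, conj_conj]
    rw [mul_comm (w j)]
  · rw [neg_rootForm, hX (by decide), hX (by decide), sigma_isotropy_single]
    congr 2
    have := congrArg (starRingEnd ℂ) hw1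
    simp only [map_mul, conj_conj, conj_I] at this
    linear_combination -(y : ℂ) * hw1 - y * this
  · rw [neg_rootForm, hX (by decide), hX (by decide), sigma_isotropy_single]
    congr 2
    have := congrArg (starRingEnd ℂ) hw2
    simp only [map_mul, conj_conj, conj_I] at this
    linear_combination -(y : ℂ) * hw2 - y * this

/-! ### The types as conjugates of the standard subspaces -/

theorem IsStd.exists_isStd {ε ε' : ℝ} (hε : ε = 1 ∨ ε = -1) (hε' : ε' = 1 ∨ ε' = -1) {τ : LTSType}
    {V : Submodule ℝ Mat} (h : IsStd ε τ V) :
    ∃ (k : SO3) (V' : Submodule ℝ Mat), IsStd ε' τ V' ∧ V = V'.map (isotropy k) := by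
  cases τ with
  | M =>
    obtain ⟨j, hj⟩ := exists_map_isotropy_stdM hε
    obtain ⟨j', hj'⟩ := exists_map_isotropy_stdM hε'
    refine ⟨j⁻¹ * j', stdM ε', rfl, ?_⟩
    rw [← map_isotropy_map_isotropy, hj', ← hj, map_isotropy_inv_map]
    exact h
  | _ => exact ⟨1, V, h, (map_isotropy_one V).symm⟩

theorem diagM_inf_span (x y z : ℝ) :
    diagM ⊓ Submodule.span ℝ {sm 0 0 0 x y z} = ⊥ := by
  refine (Submodule.eq_bot_iff _).2 ?_
  rintro X ⟨hX, hX'⟩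
  obtain ⟨a, b, c, -, rfl⟩ := mem_diagM_iff.1 hX
  obtain ⟨t, ht⟩ := Submodule.mem_span_singleton.1 hX'
  rw [smul_sm] at ht
  obtain ⟨rfl, rfl, rfl, -⟩ := sm_inj ht
  simp only [mul_zero, sm_zero]

theorem span_smul_isotropy {r : ℝ} (hr : r ≠ 0) (k : SO3) (A : Mat) :
    Submodule.span ℝ {r • isotropy k A} = (Submodule.span ℝ {A}).map (isotropy k) := by
  rw [Submodule.span_singleton_smul_eq hr.isUnit, Submodule.map_span, Set.image_singleton]

theorem isDirectSum_map_isotropy {k : SO3} {U A B : Submodule ℝ Mat} (h : A ⊓ B = ⊥) :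
    IsDirectSum U (A.map (isotropy k)) (B.map (isotropy k)) ↔ U = (A ⊔ B).map (isotropy k) := by
  rw [IsDirectSum, ← Submodule.map_inf _ (isotropy_injective k), h, Submodule.map_bot,
    Submodule.map_sup]
  exact and_iff_right rfl

/-- The scalars in the root vectors and in `M` disappear in the spans, so a basis enters only
through the sign `ε`. The last clause is what makes a basis with `ε = 1` available. -/
theorem isOfTypeRel_flatM_iff {c : ℝ} (hc : 0 < c) {k : SO3} {X : (flatM k →ₗ[ℝ] ℂ) → Mat}
    (hX : IsAdaptedChevalleyBasis c (flatM k) (rootForm k 0 1) (rootForm k 1 2) X) :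
    ∃ ε : ℝ, (ε = 1 ∨ ε = -1) ∧
      (∀ U τ, IsOfTypeRel c (flatM k) (rootForm k 0 1) (rootForm k 1 2) X U τ ↔
        ∃ V, IsStd ε τ V ∧ U = V.map (isotropy k)) ∧
      ∀ w : ℂ, X (rootForm k 0 1) = isotropy k (single 0 1 w) →
        X (rootForm k 1 2) = isotropy k (single 1 2 w) → ε = 1 := by
  obtain ⟨s, y, ε, hs, hy, hε, hM3, hM12, hw⟩ := hX.exists_M_eq hc
  have hH3 : rootVector c (flatM k) (rootForm k 0 1 + rootForm k 1 2) =
      (1 / c) • isotropy k (sm 1 0 (-1) 0 0 0) := by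
    rw [rootForm_add, rootVector_rootForm hc (by decide), ← map_smul]
    congr 1
    ext i j
    fin_cases i <;> fin_cases j <;> simp [sm]
  have hc' : 1 / c ≠ 0 := by positivity
  have hinf : ∀ x y z, Submodule.span ℝ {sm 1 0 (-1) 0 0 0} ⊓
      Submodule.span ℝ {sm 0 0 0 x y z} = ⊥ := fun x y z =>
    le_bot_iff.1 ((inf_le_inf_right _ ((Submodule.span_singleton_le_iff_mem _ _).2
      (sm_mem_diagM (by norm_num)))).trans (diagM_inf_span x y z).le)
  refine ⟨ε, hε, fun U τ => ?_, hw⟩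
  cases τ with
  | G =>
    constructor
    · rintro ⟨_, ⟨H, hH, rfl⟩, hne, rfl⟩
      refine ⟨_, ⟨H, hH, fun h => hne (by rw [h, map_zero]), rfl⟩, ?_⟩
      rw [Submodule.map_span, Set.image_singleton]
    · rintro ⟨_, ⟨H, hH, hne, rfl⟩, rfl⟩
      refine ⟨_, Submodule.mem_map_of_mem hH,
        fun h => hne (isotropy_injective k (h.trans (map_zero _).symm)), ?_⟩
      rw [Submodule.map_span, Set.image_singleton]
  | T => simp [IsOfTypeRel, IsStd]
  | S =>
    simp only [IsOfTypeRel, IsStd, exists_eq_left]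
    rw [hH3, hM3, span_smul_isotropy hc', span_smul_isotropy hs,
      isDirectSum_map_isotropy (hinf _ _ _), stdS, Submodule.span_insert]
  | M =>
    simp only [IsOfTypeRel, IsStd, exists_eq_left]
    rw [hH3, hM12, span_smul_isotropy hc', span_smul_isotropy hy,
      isDirectSum_map_isotropy (hinf _ _ _), stdM, Submodule.span_insert]
  | P =>
    simp only [IsOfTypeRel, IsStd, exists_eq_left]
    rw [hM3, span_smul_isotropy hs, isDirectSum_map_isotropy (diagM_inf_span _ _ _), stdP]

/-- A system of simple roots is unordered, while the normal form orders it. -/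
theorem IsOfTypeRel.swap {c : ℝ} {a : Submodule ℝ Mat} {α₁ α₂ : a →ₗ[ℝ] ℂ}
    {X : (a →ₗ[ℝ] ℂ) → Mat} {U : Submodule ℝ Mat} {τ : LTSType}
    (h : IsOfTypeRel c a α₁ α₂ X U τ) : IsOfTypeRel c a α₂ α₁ X U τ := by
  cases τ <;> simp only [IsOfTypeRel] at h ⊢
  · exact h
  · exact h
  · rwa [add_comm α₂]
  · rwa [add_comm α₂, add_comm (M X α₂ 1)]
  · rwa [add_comm α₂]

/-- The subspaces of type `τ` are the conjugates of the standard ones. -/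
theorem isOfType_iff {c : ℝ} (hc : 0 < c) {τ : LTSType} {U : Submodule ℝ Mat} :
    IsOfType c τ U ↔ ∃ (k : SO3) (V : Submodule ℝ Mat), IsStd 1 τ V ∧ U = V.map (isotropy k) := by
  constructor
  · rintro ⟨a, ha, α₁, α₂, hs, X, hX, hU⟩
    obtain ⟨k, rfl, h⟩ := hs.exists_eq_rootForm ha
    obtain ⟨hX', hU'⟩ : IsAdaptedChevalleyBasis c (flatM k) (rootForm k 0 1) (rootForm k 1 2) X ∧
        IsOfTypeRel c (flatM k) (rootForm k 0 1) (rootForm k 1 2) X U τ := by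
      rcases h with ⟨rfl, rfl⟩ | ⟨rfl, rfl⟩
      · exact ⟨hX, hU⟩
      · exact ⟨⟨hX.toIsChevalleyBasis, hX.neg_eq, hX.sigma_snd, hX.sigma_fst⟩, hU.swap⟩
    obtain ⟨ε, hε, hiff, -⟩ := isOfTypeRel_flatM_iff hc hX'
    obtain ⟨V, hV, rfl⟩ := (hiff U τ).1 hU'
    obtain ⟨j, V', hV', rfl⟩ := hV.exists_isStd hε (Or.inl rfl)
    exact ⟨k * j, V', hV', map_isotropy_map_isotropy k j V'⟩
  · rintro ⟨k, V, hV, rfl⟩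
    obtain ⟨X, hX, w, hw, hw'⟩ := exists_isAdaptedChevalleyBasis hc k
    obtain ⟨ε, -, hiff, hε⟩ := isOfTypeRel_flatM_iff hc hX
    obtain rfl := hε w hw hw'
    exact ⟨flatM k, isMaximalFlat_flatM k, _, _, isSimpleSystem_flatM k, X, hX,
      (hiff _ _).2 ⟨V, hV, rfl⟩⟩

/-! ### Invariants that separate the types -/

/-- All elements of `U` commute. -/
def IsAbelian (U : Submodule ℝ Mat) : Prop := ∀ u ∈ U, ∀ v ∈ U, ⁅u, v⁆ = 0

/-- The elements of `U` have a common vector in their kernels. -/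
def HasCommonKernel (U : Submodule ℝ Mat) : Prop :=
  ∃ v : Fin 3 → ℂ, v ≠ 0 ∧ ∀ A ∈ U, A *ᵥ v = 0

/-- The elements of `U` have a common eigenvector. -/
def HasCommonEigenvector (U : Submodule ℝ Mat) : Prop :=
  ∃ v : Fin 3 → ℂ, v ≠ 0 ∧ ∀ A ∈ U, ∃ μ : ℂ, A *ᵥ v = μ • v

/-- The elements of `U` are singular. -/
def IsSingular (U : Submodule ℝ Mat) : Prop := ∀ A ∈ U, A.det = 0

theorem IsAbelian.mono {U V : Submodule ℝ Mat} (h : IsAbelian V) (hUV : U ≤ V) : IsAbelian U :=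
  fun u hu v hv => h u (hUV hu) v (hUV hv)

theorem HasCommonKernel.mono {U V : Submodule ℝ Mat} (h : HasCommonKernel V) (hUV : U ≤ V) :
    HasCommonKernel U :=
  let ⟨v, hv, hA⟩ := h
  ⟨v, hv, fun A hA' => hA A (hUV hA')⟩

theorem HasCommonEigenvector.mono {U V : Submodule ℝ Mat} (h : HasCommonEigenvector V)
    (hUV : U ≤ V) : HasCommonEigenvector U :=
  let ⟨v, hv, hA⟩ := h
  ⟨v, hv, fun A hA' => hA A (hUV hA')⟩

theorem IsSingular.mono {U V : Submodule ℝ Mat} (h : IsSingular V) (hUV : U ≤ V) :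
    IsSingular U :=
  fun A hA => h A (hUV hA)

theorem isAbelian_map {U : Submodule ℝ Mat} (k : SO3) :
    IsAbelian (U.map (isotropy k)) ↔ IsAbelian U := by
  constructor
  · intro h u hu v hv
    apply isotropy_injective k
    rw [isotropy_lie, map_zero, h _ (Submodule.mem_map_of_mem hu) _ (Submodule.mem_map_of_mem hv)]
  · rintro h _ ⟨u, hu, rfl⟩ _ ⟨v, hv, rfl⟩
    rw [← isotropy_lie, h u hu v hv, map_zero]

theorem HasCommonKernel.map {U : Submodule ℝ Mat} (h : HasCommonKernel U) (k : SO3) :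
    HasCommonKernel (U.map (isotropy k)) := by
  obtain ⟨v, hv, hA⟩ := h
  refine ⟨_, cmat_mulVec_ne_zero k hv, ?_⟩
  rintro _ ⟨A, hA', rfl⟩
  rw [isotropy_mulVec, hA A hA', mulVec_zero]

theorem hasCommonKernel_map {U : Submodule ℝ Mat} (k : SO3) :
    HasCommonKernel (U.map (isotropy k)) ↔ HasCommonKernel U :=
  ⟨fun h => map_isotropy_inv_map k U ▸ h.map k⁻¹, fun h => h.map k⟩

theorem HasCommonEigenvector.map {U : Submodule ℝ Mat} (h : HasCommonEigenvector U) (k : SO3) :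
    HasCommonEigenvector (U.map (isotropy k)) := by
  obtain ⟨v, hv, hA⟩ := h
  refine ⟨_, cmat_mulVec_ne_zero k hv, ?_⟩
  rintro _ ⟨A, hA', rfl⟩
  obtain ⟨μ, hμ⟩ := hA A hA'
  exact ⟨μ, by rw [isotropy_mulVec, hμ, mulVec_smul]⟩

theorem hasCommonEigenvector_map {U : Submodule ℝ Mat} (k : SO3) :
    HasCommonEigenvector (U.map (isotropy k)) ↔ HasCommonEigenvector U :=
  ⟨fun h => map_isotropy_inv_map k U ▸ h.map k⁻¹, fun h => h.map k⟩

theorem isSingular_map {U : Submodule ℝ Mat} (k : SO3) :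
    IsSingular (U.map (isotropy k)) ↔ IsSingular U := by
  constructor
  · intro h A hA
    rw [← isotropy_det k]
    exact h _ (Submodule.mem_map_of_mem hA)
  · rintro h _ ⟨A, hA, rfl⟩
    rw [isotropy_det, h A hA]

theorem det_sm (a b c x y z : ℝ) : (sm a b c x y z).det =
    -I * (a * b * c + 2 * x * y * z - a * z ^ 2 - b * y ^ 2 - c * x ^ 2 : ℝ) := by
  rw [sm, det_smul, det_fin_three, Fintype.card_fin, I_pow_three]
  simp
  ring

theorem sm_mulVec (a b c x y z : ℝ) (v : Fin 3 → ℂ) : sm a b c x y z *ᵥ v =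
    I • ![a * v 0 + x * v 1 + y * v 2, x * v 0 + b * v 1 + z * v 2,
      y * v 0 + z * v 1 + c * v 2] := by
  rw [sm, smul_mulVec]
  congr 1
  ext i
  fin_cases i <;> simp [mulVec, dotProduct, Fin.sum_univ_three]

theorem diagM_le_stdP : diagM ≤ stdP := le_sup_left

theorem stdS_le_stdP : stdS ≤ stdP := by
  intro X hX
  obtain ⟨s, t, rfl⟩ := mem_stdS_iff.1 hX
  exact mem_stdP_iff.2 ⟨s, 0, -s, t, by ring, rfl⟩

theorem not_isAbelian_stdS : ¬ IsAbelian stdS := by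
  intro h
  have := h _ (mem_stdS_iff.2 ⟨1, 0, rfl⟩) _ (mem_stdS_iff.2 ⟨0, 1, rfl⟩)
  rw [lie_sm_sm, sk_eq_zero] at this
  norm_num at this

theorem not_isAbelian_stdM : ¬ IsAbelian (stdM 1) := by
  intro h
  have := h _ (mem_stdM_iff.2 ⟨1, 0, rfl⟩) _ (mem_stdM_iff.2 ⟨0, 1, rfl⟩)
  rw [lie_sm_sm, sk_eq_zero] at this
  norm_num at this

theorem isAbelian_diagM : IsAbelian diagM := (isFlat_iff.1 isFlat_diagM).2

theorem hasCommonKernel_stdS : HasCommonKernel stdS := by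
  refine ⟨![0, 1, 0], fun h => by simpa using congrFun h 1, fun A hA => ?_⟩
  obtain ⟨s, t, rfl⟩ := mem_stdS_iff.1 hA
  rw [sm_mulVec]
  ext i
  fin_cases i <;> simp

theorem not_hasCommonKernel_diagM : ¬ HasCommonKernel diagM := by
  rintro ⟨v, hv, h⟩
  have h1 := h _ (sm_mem_diagM (a := 1) (b := 1) (c := -2) (by norm_num))
  rw [sm_mulVec, smul_eq_zero, or_iff_right I_ne_zero] at h1
  refine hv (funext fun i => ?_)
  have := congrFun h1 i
  fin_cases i <;> simpa using this

/-- An eigenvector of `diag(1, 0, -1)` for the eigenvalue 0 is a multiple of the second unit vector,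
which the other generator does not preserve. For a non-zero eigenvalue the second coordinate
vanishes; the other generator then forces `v 2 = -v 0`, incompatible with opposite diagonal entries.
-/
theorem not_hasCommonEigenvector_stdM : ¬ HasCommonEigenvector (stdM 1) := by
  rintro ⟨v, hv, h⟩
  obtain ⟨μ, h1⟩ := h _ (mem_stdM_iff.2 ⟨1, 0, rfl⟩)
  obtain ⟨ν, h2⟩ := h _ (mem_stdM_iff.2 ⟨0, 1, rfl⟩)
  rw [sm_mulVec] at h1 h2
  have e0 := congrFun h1 0
  have e1 := congrFun h1 1
  have e2 := congrFun h1 2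
  have f0 := congrFun h2 0
  have f1 := congrFun h2 1
  have f2 := congrFun h2 2
  simp only [Pi.smul_apply, smul_eq_mul, cons_val_zero, cons_val_one, cons_val, ofReal_zero,
    ofReal_one, ofReal_neg, neg_zero, mul_one] at e0 e1 e2 f0 f1 f2
  have key : v 0 = 0 ∧ v 1 = 0 ∧ v 2 = 0 := by
    by_cases hμ : μ = 0
    · subst hμ
      have h0 : v 0 = 0 := mul_left_cancel₀ I_ne_zero (by linear_combination e0)
      have h2 : v 2 = 0 := mul_left_cancel₀ I_ne_zero (by linear_combination -e2)
      refine ⟨h0, mul_left_cancel₀ I_ne_zero ?_, h2⟩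
      rw [h0] at f0
      linear_combination f0
    · have h1 : v 1 = 0 := mul_left_cancel₀ hμ (by linear_combination -e1)
      rw [h1] at f1
      have h02 : v 2 = -v 0 := mul_left_cancel₀ I_ne_zero (by linear_combination f1)
      rw [h02] at e2
      have h0 : v 0 = 0 := mul_left_cancel₀ I_ne_zero (by linear_combination (e0 + e2) / 2)
      exact ⟨h0, h1, by rw [h02, h0, neg_zero]⟩
  refine hv (funext fun i => ?_)
  fin_cases i
  exacts [key.1, key.2.1, key.2.2]

theorem not_hasCommonKernel_stdM : ¬ HasCommonKernel (stdM 1) := by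
  rintro ⟨v, hv, h⟩
  exact not_hasCommonEigenvector_stdM ⟨v, hv, fun A hA => ⟨0, by rw [h A hA, zero_smul]⟩⟩

theorem hasCommonEigenvector_stdP : HasCommonEigenvector stdP := by
  refine ⟨![0, 1, 0], fun h => by simpa using congrFun h 1, fun A hA => ?_⟩
  obtain ⟨a, b, c, t, -, rfl⟩ := mem_stdP_iff.1 hA
  refine ⟨I * b, ?_⟩
  rw [sm_mulVec]
  ext i
  fin_cases i <;> simp

theorem isSingular_stdS : IsSingular stdS := by
  intro A hA
  obtain ⟨s, t, rfl⟩ := mem_stdS_iff.1 hA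
  rw [det_sm]
  simp

theorem isSingular_stdM : IsSingular (stdM 1) := by
  intro A hA
  obtain ⟨s, t, rfl⟩ := mem_stdM_iff.1 hA
  rw [det_sm]
  simp

theorem not_isSingular_diagM : ¬ IsSingular diagM := by
  intro h
  have := h _ (sm_mem_diagM (a := 1) (b := 1) (c := -2) (by norm_num))
  rw [det_sm] at this
  simp at this

theorem IsStd.isAbelian_iff {τ : LTSType} {V : Submodule ℝ Mat} (h : IsStd 1 τ V) :
    IsAbelian V ↔ τ = .G ∨ τ = .T := by
  cases τ with
  | G =>
    obtain ⟨H, hH, -, rfl⟩ := h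
    simpa using isAbelian_diagM.mono ((Submodule.span_singleton_le_iff_mem _ _).2 hH)
  | T => simpa using h ▸ isAbelian_diagM
  | S => simpa using h ▸ not_isAbelian_stdS
  | M => simpa using h ▸ not_isAbelian_stdM
  | P => simpa using h ▸ fun h' => not_isAbelian_stdS (h'.mono stdS_le_stdP)

theorem IsStd.hasCommonKernel_iff {τ : LTSType} {V : Submodule ℝ Mat} (h : IsStd 1 τ V)
    (hτ : τ ≠ .G) : HasCommonKernel V ↔ τ = .S := by
  cases τ with
  | G => exact absurd rfl hτ
  | T => simpa using h ▸ not_hasCommonKernel_diagM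
  | S => simpa using h ▸ hasCommonKernel_stdS
  | M => simpa using h ▸ not_hasCommonKernel_stdM
  | P => simpa using h ▸ fun h' => not_hasCommonKernel_diagM (h'.mono diagM_le_stdP)

theorem IsStd.isSingular_iff {τ : LTSType} {V : Submodule ℝ Mat} (h : IsStd 1 τ V)
    (hτ : τ ≠ .G) : IsSingular V ↔ τ = .S ∨ τ = .M := by
  cases τ with
  | G => exact absurd rfl hτ
  | T => simpa using h ▸ not_isSingular_diagM
  | S => simpa using h ▸ isSingular_stdS
  | M => simpa using h ▸ isSingular_stdM
  | P => simpa using h ▸ fun h' => not_isSingular_diagM (h'.mono diagM_le_stdP)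

/-- Singularity separates (S), (M) from (T), (P); a common kernel vector separates (S) from (M), and
commutativity separates (T) from (P). -/
theorem IsStd.eq_of_map_eq {τ τ' : LTSType} {V V' : Submodule ℝ Mat} (h : IsStd 1 τ V)
    (h' : IsStd 1 τ' V') (hτ : τ ≠ .G) (hτ' : τ' ≠ .G) {k : SO3} (e : V.map (isotropy k) = V') :
    τ = τ' := by
  subst e
  have h1 := h.isAbelian_iff.symm.trans ((isAbelian_map k).symm.trans h'.isAbelian_iff)
  have h2 := (h.hasCommonKernel_iff hτ).symm.trans
    ((hasCommonKernel_map k).symm.trans (h'.hasCommonKernel_iff hτ'))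
  have h3 := (h.isSingular_iff hτ).symm.trans
    ((isSingular_map k).symm.trans (h'.isSingular_iff hτ'))
  cases τ <;> cases τ' <;> simp at hτ hτ' h1 h2 h3 ⊢

theorem IsStd.eq {τ : LTSType} {V V' : Submodule ℝ Mat} (h : IsStd 1 τ V)
    (h' : IsStd 1 τ V') (hτ : τ ≠ .G) : V = V' := by
  cases τ with
  | G => exact absurd rfl hτ
  | T | S | M | P => exact Eq.trans h (Eq.symm h')

theorem isCongruent_iff {c : ℝ} (hc : 0 < c) {U V : Submodule ℝ Mat} {τ τ' : LTSType}
    (hτ : τ ≠ .G) (hτ' : τ' ≠ .G) (hU : IsOfType c τ U) (hV : IsOfType c τ' V) :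
    IsCongruent U V ↔ τ = τ' := by
  obtain ⟨k, A, hA, rfl⟩ := (isOfType_iff hc).1 hU
  obtain ⟨l, B, hB, rfl⟩ := (isOfType_iff hc).1 hV
  constructor
  · rintro ⟨j, e⟩
    refine hA.eq_of_map_eq hB hτ hτ' (k := l⁻¹ * (j * k)) ?_
    rw [← map_isotropy_map_isotropy, ← map_isotropy_map_isotropy, e, map_isotropy_inv_map]
  · rintro rfl
    obtain rfl := hA.eq hB hτ
    refine ⟨l * k⁻¹, ?_⟩
    rw [← map_isotropy_map_isotropy, map_isotropy_inv_map]

/-! ### Maximality -/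

theorem finrank_map_isotropy (k : SO3) (U : Submodule ℝ Mat) :
    Module.finrank ℝ (U.map (isotropy k)) = Module.finrank ℝ U :=
  (Submodule.equivMapOfInjective _ (isotropy_injective k) U).finrank_eq.symm

theorem IsStd.eq_of_map_le_map {τ : LTSType} {V V' : Submodule ℝ Mat} (h : IsStd 1 τ V)
    (h' : IsStd 1 τ V') (hτ : τ ≠ .G) {k l : SO3}
    (hle : V.map (isotropy k) ≤ V'.map (isotropy l)) :
    V.map (isotropy k) = V'.map (isotropy l) := by
  obtain rfl := h.eq h' hτ
  refine Submodule.eq_of_le_of_finrank_le hle ?_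
  rw [finrank_map_isotropy, finrank_map_isotropy]

/-- A larger proper system is again non-abelian without common kernel vector, hence of type (M) or
(P). For equal types the dimensions agree. Type (P) does not fit into (M), which consists of
singular matrices, nor (M) into (P), which has a common eigenvector. -/
theorem isMaximalLieTripleSystem_map_std {τ : LTSType} (hτ : τ = .P ∨ τ = .M)
    {V : Submodule ℝ Mat} (hV : IsStd 1 τ V) (k : SO3) :
    IsMaximalLieTripleSystem (V.map (isotropy k)) := by
  have hG : τ ≠ .G := by rintro rfl; simp at hτ
  have hab : ¬ IsAbelian V := fun h => by
    have := hV.isAbelian_iff.1 h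
    rcases hτ with rfl | rfl <;> simp at this
  have hker : ¬ HasCommonKernel V := fun h => by
    have := (hV.hasCommonKernel_iff hG).1 h
    rcases hτ with rfl | rfl <;> simp at this
  have hm : V ≠ m := by
    rintro rfl
    rcases hτ with rfl | rfl
    · have h : stdM 1 ≤ stdP := hV ▸ isLieTripleSystem_stdM.1
      exact not_hasCommonEigenvector_stdM (hasCommonEigenvector_stdP.mono h)
    · exact not_isSingular_diagM (((hV.isSingular_iff hG).2 (Or.inr rfl)).mono diagM_le_m)
  refine ⟨⟨hV.isLieTripleSystem.map_isotropy k, fun h => hm ?_⟩, ?_⟩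
  · rw [← map_isotropy_inv_map k V, h, map_isotropy_m]
  · rintro W ⟨hW, hWm⟩ hle
    have hW0 : W ≠ ⊥ := by
      rintro rfl
      refine hab ((isAbelian_map k).1 fun u hu v _ => ?_)
      rw [(Submodule.mem_bot ℝ).1 (hle hu), zero_lie]
    obtain ⟨τ', l, A, hA, rfl⟩ := classification hW hW0 hWm
    have hab' : ¬ IsAbelian A := fun h =>
      hab ((isAbelian_map k).1 (((isAbelian_map l).2 h).mono hle))
    have hker' : ¬ HasCommonKernel A := fun h =>
      hker ((hasCommonKernel_map k).1 (((hasCommonKernel_map l).2 h).mono hle))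
    by_cases hττ : τ = τ'
    · subst hττ
      exact (hV.eq_of_map_le_map hA hG hle).ge
    exfalso
    rw [hA.isAbelian_iff] at hab'
    have hG' : τ' ≠ .G := fun h => hab' (Or.inl h)
    rw [hA.hasCommonKernel_iff hG'] at hker'
    rcases hτ with rfl | rfl
    · have : τ' = .M := by cases τ' <;> simp at hab' hker' hττ ⊢
      subst this
      have := (hV.isSingular_iff hG).1 ((isSingular_map k).1
        (((isSingular_map l).2 ((hA.isSingular_iff hG').2 (Or.inr rfl))).mono hle))
      simp at this
    · have : τ' = .P := by cases τ' <;> simp at hab' hker' hττ ⊢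
      subst this
      obtain rfl : A = stdP := hA
      obtain rfl : V = stdM 1 := hV
      exact not_hasCommonEigenvector_stdM ((hasCommonEigenvector_map k).1
        (((hasCommonEigenvector_map l).2 hasCommonEigenvector_stdP).mono hle))

theorem isMaximalLieTripleSystem_iff {c : ℝ} (hc : 0 < c) {U : Submodule ℝ Mat} :
    IsMaximalLieTripleSystem U ↔ (IsOfType c .P U ∨ IsOfType c .M U) := by
  constructor
  · intro hU
    -- A maximal system contained in a conjugate of `stdP` equals it. This excludes zero and the
    -- types (G), (T), (S), whose standard forms lie properly in `stdP`.
    have hP : ∀ k : SO3, U ≤ stdP.map (isotropy k) → U = stdP.map (isotropy k) := fun k hle =>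
      hU.eq_of_le
        (isMaximalLieTripleSystem_map_std (Or.inl rfl) (show IsStd 1 .P stdP from rfl) k).1 hle
    by_cases h0 : U = ⊥
    · have := hP 1 (h0 ▸ bot_le)
      rw [map_isotropy_one] at this
      refine absurd (fun u hu v _ => ?_) not_isAbelian_stdS
      have hu' := stdS_le_stdP hu
      rw [← this, h0, Submodule.mem_bot] at hu'
      rw [hu', zero_lie]
    obtain ⟨τ, k, V, hV, rfl⟩ := classification hU.1.1 h0 hU.1.2
    have hP' : V ≤ stdP → V = stdP := fun hle => by
      have := hP k (Submodule.map_mono hle)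
      exact Submodule.map_injective_of_injective (isotropy_injective k) this
    cases τ with
    | G | T =>
      have hab := hV.isAbelian_iff.2 (by simp)
      refine absurd (hab.mono ?_) not_isAbelian_stdS
      rw [hP' ?_]
      · exact stdS_le_stdP
      · refine le_trans ?_ diagM_le_stdP
        first
        | exact le_of_eq hV
        | obtain ⟨H, hH, -, rfl⟩ := hV
          exact (Submodule.span_singleton_le_iff_mem _ _).2 hH
    | S =>
      obtain rfl : V = stdS := hV
      refine absurd (hasCommonKernel_stdS.mono ?_) not_hasCommonKernel_diagM
      rw [hP' stdS_le_stdP]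
      exact diagM_le_stdP
    | M => exact Or.inr ((isOfType_iff hc).2 ⟨k, V, hV, rfl⟩)
    | P => exact Or.inl ((isOfType_iff hc).2 ⟨k, V, hV, rfl⟩)
  · rintro (h | h)
    · obtain ⟨k, V, hV, rfl⟩ := (isOfType_iff hc).1 h
      exact isMaximalLieTripleSystem_map_std (Or.inl rfl) hV k
    · obtain ⟨k, V, hV, rfl⟩ := (isOfType_iff hc).1 h
      exact isMaximalLieTripleSystem_map_std (Or.inr rfl) hV k

theorem isLieTripleSystem_iff {c : ℝ} (hc : 0 < c) {U : Submodule ℝ Mat} (h0 : U ≠ ⊥)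
    (hm : U < m) : IsLieTripleSystem U ↔ ∃ τ : LTSType, IsOfType c τ U := by
  constructor
  · intro hU
    obtain ⟨τ, k, V, hV, e⟩ := classification hU h0 hm.ne
    exact ⟨τ, (isOfType_iff hc).2 ⟨k, V, hV, e⟩⟩
  · rintro ⟨τ, h⟩
    obtain ⟨k, V, hV, rfl⟩ := (isOfType_iff hc).1 h
    exact hV.isLieTripleSystem.map_isotropy k

end SU3SO3

theorem mainTheorem1 (c : ℝ) (hc : 0 < c) :
    (∀ U : Submodule ℝ SU3SO3.Mat, U ≠ ⊥ → U < SU3SO3.m →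
      (SU3SO3.IsLieTripleSystem U ↔ ∃ τ : SU3SO3.LTSType, SU3SO3.IsOfType c τ U)) ∧
    (∀ (U V : Submodule ℝ SU3SO3.Mat) (τ τ' : SU3SO3.LTSType),
      τ ≠ SU3SO3.LTSType.G → τ' ≠ SU3SO3.LTSType.G →
      SU3SO3.IsOfType c τ U → SU3SO3.IsOfType c τ' V →
      (SU3SO3.IsCongruent U V ↔ τ = τ')) ∧
    (∀ U : Submodule ℝ SU3SO3.Mat, SU3SO3.IsMaximalLieTripleSystem U ↔
      (SU3SO3.IsOfType c SU3SO3.LTSType.P U ∨ SU3SO3.IsOfType c SU3SO3.LTSType.M U)) :=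
  ⟨fun _ h0 hm => SU3SO3.isLieTripleSystem_iff hc h0 hm,
    fun _ _ _ _ hτ hτ' hU hV => SU3SO3.isCongruent_iff hc hτ hτ' hU hV,
    fun _ => SU3SO3.isMaximalLieTripleSystem_iff hc⟩
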